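/- Let $N\ge 1$ be an integer. There exist functions $A,B,C\in C^\infty(\mathbb R)$ (real-valued) and a number $\delta_A\in(0,1/2)$ such that: 1. the supports of $A$, $B$ and $C$ are included in $[-1,1]$; 2. $\{z>0:\ B(z)\neq 0 \text{ and } C(z)\neq 0\}\neq\emptyset$; 3. $A$, $B$ and $C$ are even: $A(z)=A(-z)$, $B(z)=B(-z)$, $C(z)=C(-z)$ for all $z\in\mathbb R$; 4. $A(z)=e^{-1/(1-z^2)}$ whenever $1-\delta_A<z<1$; 5. $-A''(z)-\frac{N-1}{z}A'(z)=B(z)^3$ for all $z\in\mathbb R\setminus\{0\}$; 6. $-B''(z)-\frac{N-1}{z}B'(z)=C(z)^3$ for all $z\in\mathbb R\setminus\{0\}$; 7. for $z\in\mathbb R$: ($z\in[0,1)$ and $B(z)=0$) if and only if $z=\frac12$; 8. $B'(\tfrac12)<0$; 9. $C(\tfrac12)>0$; 10. if $z\in[0,1)$ and $C(z)=0$, then $z\in(0,1)$ and $C'(z)\neq 0$. -/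

import Mathlib

open scoped ContDiff

/-! With `n = N - 1`, the cascade is solved from the source upwards. Take `g = w * p` with `w =
cubicWeight a b`, `1/2 < a < b < 1`, and `p` even, positive on `[0,1)` and zero beyond `1`. Put `C =
p^(1/3) (z² - a²)(z² - b²)`, so that `C³ = g`. Then `B` is the radial potential of `g` and `A` that
of `B³`. The simple factors in `C` give transversal zeros at `a` and `b`.

Three scalar conditions remain: zero total flux of `g` (so `B` vanishes beyond `1`), `B(1/2) = 0`,
and zero total flux of `B³` (so `A` vanishes beyond `1`). The sign pattern +, -, + of `g` then
forces `B > 0` on `[0,1/2)` and `B < 0` on `(1/2,1)`.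

The shape of `A` near `1` is prescribed through `p`. In `y = 1 - z²`, functions `exp(-c/y) y^(-α)
q(y)` are stable under the radial operator, and under cube roots when `q` has no zero. Running
`exp(-1/y)` through the cascade thus fixes `p` near `1` (`exists_boundary_profile`); uniqueness from
outside (`eqOn_Ioi_of_radial_equation`) identifies `A` and `B` there with these profiles.

A nonnegative bump added to `p` away from `1` adjusts the three conditions. The two linear moments
of bumps in the three sign zones of `w` positively span the plane (`exists_spanning_bumps`). The
third is cubic along a ray of balanced bumps, with leading coefficient of either sign available
(`exists_bump_cubicMoment_pos`, `exists_bump_cubicMoment_neg`), so it has a root with nonnegative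
parameter (`exists_bump_balancing_all_moments`). -/

/-! ### Inverting the radial operator smoothly across the origin. -/

/-- The weighted mean `∫₀¹ tⁿ g(tz) dt`. -/
noncomputable def radialMean (n : ℕ) (g : ℝ → ℝ) (z : ℝ) : ℝ :=
  ∫ t in (0 : ℝ)..1, t ^ n * g (t * z)

/-- The flux `∫₀ᶻ sⁿ g(s) ds` of a radial density through the sphere of radius `z`. -/
noncomputable def radialFlux (n : ℕ) (g : ℝ → ℝ) (z : ℝ) : ℝ :=
  ∫ s in (0 : ℝ)..z, s ^ n * g s

/-- The radial solution of `-u'' - (n / z) u' = g` with `u(1) = 0`. -/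
noncomputable def radialPotential (n : ℕ) (g : ℝ → ℝ) (z : ℝ) : ℝ :=
  ∫ s in z..1, s * radialMean n g s

theorem hasDerivAt_radialMean {n : ℕ} {g : ℝ → ℝ} (hg : ContDiff ℝ 1 g) (z : ℝ) :
    HasDerivAt (radialMean n g) (radialMean (n + 1) (deriv g) z) z := by
  have hg' : Continuous (deriv g) := hg.continuous_deriv le_rfl
  have hgc := hg.continuous
  have hc : Continuous (fun q : ℝ × ℝ => q.2 ^ (n + 1) * deriv g (q.2 * q.1)) := by fun_prop
  obtain ⟨K, hK⟩ := ((isCompact_closedBall z 1).prod (isCompact_Icc (a := (0 : ℝ)) (b := 1))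
    ).exists_bound_of_continuousOn hc.continuousOn
  have key := intervalIntegral.hasDerivAt_integral_of_dominated_loc_of_deriv_le
    (μ := MeasureTheory.volume) (a := (0 : ℝ)) (b := 1) (𝕜 := ℝ)
    (F := fun x t => t ^ n * g (t * x)) (F' := fun x t => t ^ (n + 1) * deriv g (t * x))
    (x₀ := z) (s := Metric.closedBall z 1) (bound := fun _ => K)
    (Metric.closedBall_mem_nhds z one_pos)
    (Filter.Eventually.of_forall fun x => by
      exact (by fun_prop : Continuous fun t : ℝ => t ^ n * g (t * x)).aestronglyMeasurable)
    ((by fun_prop : Continuous fun t : ℝ => t ^ n * g (t * z)).intervalIntegrable _ _)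
    ((by fun_prop : Continuous fun t : ℝ => t ^ (n + 1) * deriv g (t * z)).aestronglyMeasurable)
    (by
      refine Filter.Eventually.of_forall fun t ht x hx => hK (x, t) ⟨hx, ?_⟩
      rw [Set.uIoc_of_le zero_le_one] at ht
      exact ⟨ht.1.le, ht.2⟩)
    (intervalIntegrable_const)
    (by
      refine Filter.Eventually.of_forall fun t ht x hx => ?_
      have h1 : HasDerivAt (fun x => t * x) t x := by simpa using (hasDerivAt_id x).const_mul t
      have h2 := ((hg.differentiable one_ne_zero (t * x)).hasDerivAt.comp x h1).const_mul (t ^ n)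
      refine h2.congr_deriv ?_
      ring)
  exact key.2

/-- Differentiation turns a mean into another mean, of `deriv g` with weight `n + 1`, so the
induction on the order must generalize `n` and `g`. Using means instead of flux divided by a power
avoids any singularity at `0`. -/
theorem contDiff_radialMean {g : ℝ → ℝ} (hg : ContDiff ℝ ∞ g) (n : ℕ) :
    ContDiff ℝ ∞ (radialMean n g) := by
  rw [contDiff_infty]
  intro k
  induction k generalizing n g with
  | zero =>
    exact contDiff_zero.2 (continuous_iff_continuousAt.2 fun z =>
      (hasDerivAt_radialMean (hg.of_le (by simp)) z).continuousAt)
  | succ k ih =>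
    have hd := fun z => hasDerivAt_radialMean (n := n)
      (hg.of_le (by simp)) z
    push_cast
    rw [contDiff_succ_iff_deriv]
    refine ⟨fun z => (hd z).differentiableAt, by simp, ?_⟩
    rw [funext fun z => (hd z).deriv]
    exact ih (contDiff_infty_iff_deriv.1 hg).2 (n + 1)

theorem pow_mul_radialMean (n : ℕ) (g : ℝ → ℝ) (z : ℝ) :
    z ^ (n + 1) * radialMean n g z = radialFlux n g z := by
  have h := intervalIntegral.mul_integral_comp_mul_right (a := (0 : ℝ)) (b := 1)
    (f := fun s => s ^ n * g s) z
  simp only [zero_mul, one_mul] at h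
  rw [radialFlux, ← h, radialMean, pow_succ', mul_assoc, ← intervalIntegral.integral_const_mul]
  congr 2
  ext t
  ring

theorem continuous_radialMean {g : ℝ → ℝ} (hg : Continuous g) (n : ℕ) :
    Continuous (radialMean n g) :=
  intervalIntegral.continuous_parametric_intervalIntegral_of_continuous' (by fun_prop) 0 1

theorem hasDerivAt_radialFlux {n : ℕ} {g : ℝ → ℝ} (hg : Continuous g) (z : ℝ) :
    HasDerivAt (radialFlux n g) (z ^ n * g z) z :=
  (by fun_prop : Continuous fun s => s ^ n * g s).integral_hasStrictDerivAt 0 z |>.hasDerivAt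

theorem hasDerivAt_radialPotential {n : ℕ} {g : ℝ → ℝ} (hg : Continuous g) (z : ℝ) :
    HasDerivAt (radialPotential n g) (-(z * radialMean n g z)) z := by
  have hc : Continuous fun s => s * radialMean n g s :=
    continuous_id.mul (continuous_radialMean hg n)
  exact intervalIntegral.integral_hasDerivAt_left (hc.intervalIntegrable _ _)
    (hc.stronglyMeasurableAtFilter _ _) hc.continuousAt

theorem deriv_radialPotential {n : ℕ} {g : ℝ → ℝ} (hg : Continuous g) :
    deriv (radialPotential n g) = fun z => -(z * radialMean n g z) :=
  funext fun z => (hasDerivAt_radialPotential hg z).deriv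

theorem contDiff_radialPotential {g : ℝ → ℝ} (hg : ContDiff ℝ ∞ g) (n : ℕ) :
    ContDiff ℝ ∞ (radialPotential n g) := by
  rw [contDiff_infty_iff_deriv, deriv_radialPotential hg.continuous]
  exact ⟨fun z => (hasDerivAt_radialPotential hg.continuous z).differentiableAt,
    (contDiff_id.mul (contDiff_radialMean hg n)).neg⟩

theorem continuous_radialPotential {g : ℝ → ℝ} (hg : Continuous g) (n : ℕ) :
    Continuous (radialPotential n g) :=
  continuous_iff_continuousAt.2 fun z => (hasDerivAt_radialPotential hg z).continuousAt

theorem radialPotential_one (n : ℕ) (g : ℝ → ℝ) : radialPotential n g 1 = 0 := by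
  simp [radialPotential]

theorem radialPotential_neg {g : ℝ → ℝ} (hg : Continuous g) (he : ∀ z, g (-z) = g z) (n : ℕ)
    (z : ℝ) : radialPotential n g (-z) = radialPotential n g z := by
  have hm : ∀ z, radialMean n g (-z) = radialMean n g z := fun z => by
    simp only [radialMean, mul_neg, he]
  -- The potential is based at `1`, so reflection is not a mere substitution; instead the difference
  -- has zero derivative and vanishes at `0`.
  have hd : ∀ z, HasDerivAt (fun z => radialPotential n g (-z) - radialPotential n g z) 0 z := by
    intro z
    have h := ((hasDerivAt_radialPotential (n := n) hg (-z)).comp z (hasDerivAt_neg z)).sub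
      (hasDerivAt_radialPotential (n := n) hg z)
    refine h.congr_deriv ?_
    rw [hm]; ring
  have := is_const_of_deriv_eq_zero (fun z => (hd z).differentiableAt) (fun z => (hd z).deriv) z 0
  simp only [neg_zero, sub_self] at this
  linarith

theorem radialPotential_equation {g : ℝ → ℝ} (hg : ContDiff ℝ ∞ g) (n : ℕ) {z : ℝ} (hz : z ≠ 0) :
    -(deriv (deriv (radialPotential n g)) z) - (n : ℝ) / z * deriv (radialPotential n g) z
      = g z := by
  have hH : HasDerivAt (radialMean n g) (deriv (radialMean n g) z) z :=
    ((contDiff_radialMean hg n).differentiable (by simp) z).hasDerivAt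
  -- Differentiating `z^(n+1) * mean = flux` in two ways is the equation in divergence form.
  have h1 := (hasDerivAt_pow (n + 1) z).mul hH
  have h2 : (fun z => z ^ (n + 1)) * radialMean n g = radialFlux n g :=
    funext fun z => pow_mul_radialMean n g z
  rw [h2] at h1
  have h3 := h1.unique (hasDerivAt_radialFlux hg.continuous z)
  have h4 : deriv (fun z => -(z * radialMean n g z)) z
      = -(radialMean n g z + z * deriv (radialMean n g) z) := by
    simpa using ((hasDerivAt_id' z).fun_mul hH).fun_neg.deriv
  rw [deriv_radialPotential hg.continuous, h4]
  have hzn : z ^ n ≠ 0 := pow_ne_zero n hz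
  apply mul_left_cancel₀ hzn
  rw [← h3]
  simp only [Nat.add_sub_cancel]
  push_cast
  field_simp
  ring

theorem radialFlux_eq_of_one_le {n : ℕ} {g : ℝ → ℝ} (hg : Continuous g)
    (h0 : ∀ z, 1 ≤ z → g z = 0) {z : ℝ} (hz : 1 ≤ z) : radialFlux n g z = radialFlux n g 1 := by
  have hc : Continuous fun s => s ^ n * g s := by fun_prop
  have h := intervalIntegral.integral_add_adjacent_intervals (hc.intervalIntegrable 0 1)
    (hc.intervalIntegrable 1 z) (μ := MeasureTheory.volume)
  have h2 : ∫ s in (1 : ℝ)..z, s ^ n * g s = 0 := by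
    rw [intervalIntegral.integral_congr (g := fun _ => (0 : ℝ))]
    · simp
    · intro s hs
      rw [Set.uIcc_of_le hz] at hs
      simp [h0 s hs.1]
  rw [radialFlux, radialFlux, ← h, h2, add_zero]

theorem radialPotential_eq_zero_of_one_le {n : ℕ} {g : ℝ → ℝ} (hg : Continuous g)
    (h0 : ∀ z, 1 ≤ z → g z = 0) (h1 : radialFlux n g 1 = 0) {z : ℝ} (hz : 1 ≤ z) :
    radialPotential n g z = 0 := by
  rw [radialPotential, intervalIntegral.integral_congr (g := fun _ => (0 : ℝ))]
  · simp
  · intro s hs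
    rw [Set.uIcc_of_ge hz] at hs
    have h := pow_mul_radialMean n g s
    rw [radialFlux_eq_of_one_le hg h0 hs.1, h1] at h
    have : s ^ (n + 1) ≠ 0 := pow_ne_zero _ (by linarith [hs.1])
    simp [(mul_eq_zero.1 h).resolve_left this]

/-- Two radial solutions that vanish beyond `1` agree wherever they have the same source. -/
theorem eqOn_Ioi_of_radial_equation {n : ℕ} {u v : ℝ → ℝ} {d : ℝ} (hd : 0 < d) (hd1 : d < 1)
    (hu : ContDiff ℝ ∞ u) (hv : ContDiff ℝ ∞ v)
    (hu0 : ∀ z, 1 ≤ z → u z = 0) (hv0 : ∀ z, 1 ≤ z → v z = 0)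
    (h : ∀ z, d < z → -(deriv (deriv u) z) - (n : ℝ) / z * deriv u z
      = -(deriv (deriv v) z) - (n : ℝ) / z * deriv v z) :
    Set.EqOn u v (Set.Ioi d) := by
  have key : ∀ f : ℝ → ℝ, ContDiff ℝ ∞ f → (∀ z, 1 ≤ z → f z = 0) →
      (∀ z, d < z → -(deriv (deriv f) z) - (n : ℝ) / z * deriv f z = 0) →
      ∀ z, d < z → f z = 0 := by
    intro f hf hf0 hfe
    have hf' := (contDiff_infty_iff_deriv.1 hf).2
    -- Any point beyond `1` would do: `f` vanishes in a neighbourhood of it.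
    have hd2 : deriv f 2 = 0 := by
      have : f =ᶠ[nhds 2] fun _ => 0 := by
        filter_upwards [Ioi_mem_nhds (show (1 : ℝ) < 2 by norm_num)] with z hz using hf0 z hz.le
      rw [this.deriv_eq]; simp
    have hflux : ∀ z, d < z → deriv f z = 0 := by
      intro z hz
      -- The flux `zⁿ f'` is conserved for the homogeneous equation, and it vanishes at `2`.
      have hD : ∀ x ∈ Set.Ioi d, HasDerivAt (fun z => z ^ n * deriv f z) 0 x := by
        intro x hx
        have hx0 : x ≠ 0 := (hd.trans hx).ne'
        refine ((hasDerivAt_pow n x).mul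
          (hf'.differentiable (by simp) x).hasDerivAt).congr_deriv ?_
        have := hfe x hx
        have h2 : deriv (deriv f) x = - ((n : ℝ) / x * deriv f x) := by linarith
        rw [h2]
        rcases n with _ | m
        · simp
        · simp only [Nat.add_sub_cancel]
          field_simp
          ring
      have := (convex_Ioi d).is_const_of_fderivWithin_eq_zero (𝕜 := ℝ)
        (f := fun z => z ^ n * deriv f z)
        (fun x hx => (hD x hx).differentiableAt.differentiableWithinAt)
        (fun x hx => by
          rw [fderivWithin_of_isOpen isOpen_Ioi hx, ← toSpanSingleton_deriv, (hD x hx).deriv]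
          simp) hz (show (2 : ℝ) ∈ Set.Ioi d by simp; linarith)
      simp only [hd2, mul_zero] at this
      exact (mul_eq_zero.1 this).resolve_left (pow_ne_zero n (hd.trans hz).ne')
    intro z hz
    have := (convex_Ioi d).is_const_of_fderivWithin_eq_zero (𝕜 := ℝ) (f := f)
        (fun x _ => (hf.differentiable (by simp) x).differentiableWithinAt)
        (fun x hx => by
          rw [fderivWithin_of_isOpen isOpen_Ioi hx, ← toSpanSingleton_deriv, hflux x hx]
          simp) hz (show (1 : ℝ) ∈ Set.Ioi d from hd1)
    rw [this, hf0 1 le_rfl]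
  intro z hz
  have hu' := (contDiff_infty_iff_deriv.1 hu).2
  have hv' := (contDiff_infty_iff_deriv.1 hv).2
  have h1 : deriv (u - v) = deriv u - deriv v := funext fun x =>
    deriv_sub (hu.differentiable (by simp) x) (hv.differentiable (by simp) x)
  have := key (u - v) (hu.sub hv) (fun z hz => by simp [hu0 z hz, hv0 z hz]) (fun x hx => by
    rw [h1, deriv_sub (hu'.differentiable (by simp) x) (hv'.differentiable (by simp) x)]
    have := h x hx
    simp only [Pi.sub_apply, mul_sub]
    linarith) z hz
  exact sub_eq_zero.1 this

theorem radialFlux_add_smul {n : ℕ} {g h : ℝ → ℝ} (hg : Continuous g) (hh : Continuous h)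
    (c z : ℝ) : radialFlux n (fun x => g x + c * h x) z
      = radialFlux n g z + c * radialFlux n h z := by
  simp only [radialFlux]
  rw [← intervalIntegral.integral_const_mul, ← intervalIntegral.integral_add
    ((by fun_prop : Continuous _).intervalIntegrable _ _)
    ((by fun_prop : Continuous _).intervalIntegrable _ _)]
  congr 1; ext; ring

theorem radialMean_add_smul {n : ℕ} {g h : ℝ → ℝ} (hg : Continuous g) (hh : Continuous h)
    (c z : ℝ) : radialMean n (fun x => g x + c * h x) z
      = radialMean n g z + c * radialMean n h z := by
  simp only [radialMean]
  rw [← intervalIntegral.integral_const_mul, ← intervalIntegral.integral_add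
    ((by fun_prop : Continuous _).intervalIntegrable _ _)
    ((by fun_prop : Continuous _).intervalIntegrable _ _)]
  congr 1; ext; ring

theorem radialPotential_add_smul {n : ℕ} {g h : ℝ → ℝ} (hg : Continuous g) (hh : Continuous h)
    (c z : ℝ) : radialPotential n (fun x => g x + c * h x) z
      = radialPotential n g z + c * radialPotential n h z := by
  have h1 := continuous_radialMean hg n
  have h2 := continuous_radialMean hh n
  simp only [radialPotential, radialMean_add_smul hg hh]
  rw [← intervalIntegral.integral_const_mul, ← intervalIntegral.integral_add
    ((by fun_prop : Continuous _).intervalIntegrable _ _)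
    ((by fun_prop : Continuous _).intervalIntegrable _ _)]
  congr 1; ext; ring

/-! ### Flat functions and the boundary profile. -/

/-- The function `exp(-c/y) y^(-α) q(y)` for `y > 0`, extended by zero. -/
noncomputable def flatGlue (c α : ℝ) (q : ℝ → ℝ) (y : ℝ) : ℝ :=
  if 0 < y then Real.exp (-c / y) * y ^ (-α) * q y else 0

/-- The coefficient of the derivative of `flatGlue c α q`, which is again a `flatGlue`. -/
noncomputable def flatCoeff (c α : ℝ) (q : ℝ → ℝ) (y : ℝ) : ℝ :=
  c * q y - α * y * q y + y ^ 2 * deriv q y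

theorem flatGlue_of_pos {c α y : ℝ} {q : ℝ → ℝ} (hy : 0 < y) :
    flatGlue c α q y = Real.exp (-c / y) * y ^ (-α) * q y := if_pos hy

theorem flatGlue_of_nonpos {c α y : ℝ} {q : ℝ → ℝ} (hy : y ≤ 0) :
    flatGlue c α q y = 0 := if_neg hy.not_gt

theorem contDiff_flatCoeff {q : ℝ → ℝ} (hq : ContDiff ℝ ∞ q) (c α : ℝ) :
    ContDiff ℝ ∞ (flatCoeff c α q) := by
  have := (contDiff_infty_iff_deriv.1 hq).2
  unfold flatCoeff
  fun_prop

theorem tendsto_flatGlue {c : ℝ} (hc : 0 < c) (α : ℝ) {q : ℝ → ℝ} (hq : Continuous q) :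
    Filter.Tendsto (flatGlue c α q) (nhds 0) (nhds 0) := by
  have h1 : Filter.Tendsto (fun y : ℝ => Real.exp (-c / y) * y ^ (-α)) (nhdsWithin 0 (Set.Ioi 0))
      (nhds 0) := by
    have h := (tendsto_rpow_mul_exp_neg_mul_atTop_nhds_zero α c hc).comp
      tendsto_inv_nhdsGT_zero
    refine h.congr' ?_
    filter_upwards [self_mem_nhdsWithin] with y hy
    have hy : 0 < y := hy
    simp only [Function.comp]
    rw [Real.inv_rpow hy.le, Real.rpow_neg hy.le, mul_comm]
    rfl
  have h2 := h1.mul (hq.continuousAt (x := 0).tendsto.mono_left nhdsWithin_le_nhds)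
  rw [zero_mul] at h2
  have h3 : Filter.Tendsto (flatGlue c α q)
      (nhdsWithin 0 (Set.Iic 0) ⊔ nhdsWithin 0 (Set.Ioi 0)) (nhds 0) := by
    refine Filter.Tendsto.sup (tendsto_const_nhds.congr' ?_) (h2.congr' ?_)
    · filter_upwards [self_mem_nhdsWithin] with y hy using (flatGlue_of_nonpos hy).symm
    · filter_upwards [self_mem_nhdsWithin] with y hy using (flatGlue_of_pos hy).symm
  rwa [nhdsLE_sup_nhdsGT] at h3

theorem hasDerivAt_flatGlue {c : ℝ} (hc : 0 < c) (α : ℝ) {q : ℝ → ℝ} (hq : ContDiff ℝ ∞ q)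
    (y : ℝ) : HasDerivAt (flatGlue c α q) (flatGlue c (α + 2) (flatCoeff c α q) y) y := by
  rcases lt_trichotomy y 0 with hy | rfl | hy
  · rw [flatGlue_of_nonpos hy.le]
    refine (hasDerivAt_const y (0 : ℝ)).congr_of_eventuallyEq ?_
    filter_upwards [Iio_mem_nhds hy] with x hx using flatGlue_of_nonpos hx.le
  · rw [flatGlue_of_nonpos le_rfl, hasDerivAt_iff_tendsto_slope]
    -- The difference quotient at `0` is again flat, with `α` raised by one.
    refine ((tendsto_flatGlue hc (α + 1) hq.continuous).mono_left nhdsWithin_le_nhds).congr' ?_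
    filter_upwards [self_mem_nhdsWithin] with x hx
    rw [slope_def_field, flatGlue_of_nonpos (le_refl (0 : ℝ))]
    rcases lt_or_gt_of_ne hx with h | h
    · simp [flatGlue_of_nonpos h.le]
    · rw [flatGlue_of_pos h, flatGlue_of_pos h, neg_add, Real.rpow_add h, Real.rpow_neg_one]
      field_simp
      ring
  · have h1 : HasDerivAt (fun y : ℝ => Real.exp (-c / y) * y ^ (-α) * q y)
        (flatGlue c (α + 2) (flatCoeff c α q) y) y := by
      have e1 : HasDerivAt (fun y : ℝ => -c / y) (c / y ^ 2) y := by
        have := (hasDerivAt_inv hy.ne').const_mul (-c)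
        refine this.congr_deriv ?_
        field_simp
      have e2 := Real.hasDerivAt_rpow_const (p := -α) (Or.inl hy.ne')
      have e3 := (hq.differentiable (by simp) y).hasDerivAt
      refine ((e1.exp.fun_mul e2).fun_mul e3).congr_deriv ?_
      rw [flatGlue_of_pos hy, flatCoeff, neg_add, Real.rpow_add hy, Real.rpow_sub_one hy.ne',
        Real.rpow_neg hy.le 2, Real.rpow_two]
      field_simp
      ring
    refine h1.congr_of_eventuallyEq ?_
    filter_upwards [Ioi_mem_nhds hy] with x hx using flatGlue_of_pos hx

theorem deriv_flatGlue {c : ℝ} (hc : 0 < c) (α : ℝ) {q : ℝ → ℝ} (hq : ContDiff ℝ ∞ q) :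
    deriv (flatGlue c α q) = flatGlue c (α + 2) (flatCoeff c α q) :=
  funext fun y => (hasDerivAt_flatGlue hc α hq y).deriv

theorem contDiff_flatGlue {c : ℝ} (hc : 0 < c) (α : ℝ) {q : ℝ → ℝ} (hq : ContDiff ℝ ∞ q) :
    ContDiff ℝ ∞ (flatGlue c α q) := by
  rw [contDiff_infty]
  intro k
  induction k generalizing α q with
  | zero =>
    exact contDiff_zero.2 (continuous_iff_continuousAt.2 fun y =>
      (hasDerivAt_flatGlue hc α hq y).continuousAt)
  | succ k ih =>
    push_cast
    rw [contDiff_succ_iff_deriv, deriv_flatGlue hc α hq]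
    exact ⟨fun y => (hasDerivAt_flatGlue hc α hq y).differentiableAt, by simp,
      ih _ (contDiff_flatCoeff hq c α)⟩

theorem flatGlue_cube (c α : ℝ) (q : ℝ → ℝ) (y : ℝ) :
    flatGlue c α q y ^ 3 = flatGlue (3 * c) (3 * α) (fun y => q y ^ 3) y := by
  rcases le_or_gt y 0 with hy | hy
  · simp [flatGlue_of_nonpos hy]
  · rw [flatGlue_of_pos hy, flatGlue_of_pos hy, mul_pow, mul_pow, ← Real.exp_nat_mul,
      ← Real.rpow_mul_natCast hy.le]
    congr 3
    · push_cast; ring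
    · push_cast; ring

theorem flatGlue_pos {c α y : ℝ} {q : ℝ → ℝ} (hy : 0 < y) (hq : 0 < q y) :
    0 < flatGlue c α q y := by
  rw [flatGlue_of_pos hy]
  positivity

/-- The radial operator in the variable `y = 1 - z ^ 2`. -/
theorem radial_operator_comp {φ : ℝ → ℝ} (hφ : ContDiff ℝ ∞ φ) (n : ℕ) {z : ℝ} (hz : z ≠ 0) :
    -(deriv (deriv fun z => φ (1 - z ^ 2)) z) - (n : ℝ) / z * deriv (fun z => φ (1 - z ^ 2)) z
      = -4 * z ^ 2 * deriv (deriv φ) (1 - z ^ 2) + 2 * (n + 1) * deriv φ (1 - z ^ 2) := by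
  have hφ' := (contDiff_infty_iff_deriv.1 hφ).2
  have e : ∀ z : ℝ, HasDerivAt (fun z : ℝ => 1 - z ^ 2) (-(2 * z)) z := fun z => by
    simpa using (hasDerivAt_pow 2 z).const_sub 1
  have h1 : deriv (fun z => φ (1 - z ^ 2)) = fun z => deriv φ (1 - z ^ 2) * -(2 * z) :=
    funext fun z => ((hφ.differentiable (by simp) (1 - z ^ 2)).hasDerivAt.comp z (e z)).deriv
  have h3 : HasDerivAt (fun z => deriv φ (1 - z ^ 2))
      (deriv (deriv φ) (1 - z ^ 2) * -(2 * z)) z :=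
    HasDerivAt.comp (h₂ := deriv φ) z (hφ'.differentiable (by simp) _).hasDerivAt (e z)
  have h2 : deriv (fun z => deriv φ (1 - z ^ 2) * -(2 * z)) z
      = deriv (deriv φ) (1 - z ^ 2) * -(2 * z) * -(2 * z) + deriv φ (1 - z ^ 2) * -(2 * 1) :=
    (h3.fun_mul ((hasDerivAt_id' z).const_mul 2).fun_neg).deriv
  rw [h1, h2]
  field_simp
  ring

/-- The coefficient produced by the radial operator from `flatGlue c α q`. -/
noncomputable def flatRadialCoeff (n : ℕ) (c α : ℝ) (q : ℝ → ℝ) (y : ℝ) : ℝ :=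
  -4 * (1 - y) * flatCoeff c (α + 2) (flatCoeff c α q) y
    + 2 * (n + 1) * y ^ 2 * flatCoeff c α q y

theorem contDiff_flatRadialCoeff {q : ℝ → ℝ} (hq : ContDiff ℝ ∞ q) (n : ℕ) (c α : ℝ) :
    ContDiff ℝ ∞ (flatRadialCoeff n c α q) := by
  have h1 := contDiff_flatCoeff hq c α
  have h2 := contDiff_flatCoeff h1 c (α + 2)
  unfold flatRadialCoeff
  fun_prop

/-- At the boundary only the twice differentiated exponential survives. Hence the operator flips the
sign of the coefficient there, and a coefficient nonzero at `0` stays so, as the cube root needs. -/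
theorem flatRadialCoeff_zero (n : ℕ) (c α : ℝ) (q : ℝ → ℝ) :
    flatRadialCoeff n c α q 0 = -4 * c ^ 2 * q 0 := by
  simp [flatRadialCoeff, flatCoeff]
  ring

theorem radial_operator_flatGlue {c : ℝ} (hc : 0 < c) (α : ℝ) {q : ℝ → ℝ} (hq : ContDiff ℝ ∞ q)
    (n : ℕ) {z : ℝ} (hz : z ≠ 0) :
    -(deriv (deriv fun z => flatGlue c α q (1 - z ^ 2)) z)
        - (n : ℝ) / z * deriv (fun z => flatGlue c α q (1 - z ^ 2)) z
      = flatGlue c (α + 4) (flatRadialCoeff n c α q) (1 - z ^ 2) := by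
  rw [radial_operator_comp (contDiff_flatGlue hc α hq) n hz, deriv_flatGlue hc α hq,
    deriv_flatGlue hc _ (contDiff_flatCoeff hq c α), add_assoc]
  norm_num
  rcases le_or_gt (1 - z ^ 2) 0 with hy | hy
  · simp [flatGlue_of_nonpos hy]
  · rw [flatGlue_of_pos hy, flatGlue_of_pos hy, flatGlue_of_pos hy, flatRadialCoeff,
      show -(α + 2) = -(α + 4) + 2 by ring, Real.rpow_add hy, Real.rpow_two]
    ring

/-- A cutoff interpolates between `Q` near `0` and the constant `1`; convex combinations of positive
numbers are positive. Real powers of the result are then globally smooth. -/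
theorem exists_contDiff_pos_eqOn {Q : ℝ → ℝ} (hQ : ContDiff ℝ ∞ Q) (h0 : 0 < Q 0) :
    ∃ ε > 0, ∃ R : ℝ → ℝ, ContDiff ℝ ∞ R ∧ (∀ y, 0 < R y) ∧ ∀ y, |y| < ε → R y = Q y := by
  obtain ⟨r, hr, hball⟩ := Metric.isOpen_iff.1 (isOpen_lt continuous_const hQ.continuous) 0 h0
  let f : ContDiffBump (0 : ℝ) := ⟨r / 2, r, by positivity, by linarith⟩
  refine ⟨r / 2, by positivity, fun y => f y * Q y + (1 - f y), ?_, fun y => ?_, fun y hy => ?_⟩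
  · have := f.contDiff (n := ⊤)
    exact (this.mul hQ).add (contDiff_const.sub this)
  · by_cases hy : y ∈ Metric.ball (0 : ℝ) r
    · have h1 : 0 < Q y := hball hy
      have h2 : 0 < f y := f.pos_of_mem_ball hy
      have h3 : f y ≤ 1 := f.le_one
      nlinarith [mul_pos h2 h1]
    · have : f y = 0 := f.zero_of_le_dist (by simpa using hy)
      simp [this]
  · have : f y = 1 := f.one_of_mem_closedBall (by simpa using hy.le)
    simp [this]

theorem contDiff_rpow_of_pos {R : ℝ → ℝ} (hR : ContDiff ℝ ∞ R) (hpos : ∀ y, 0 < R y) (s : ℝ) :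
    ContDiff ℝ ∞ fun y => R y ^ s :=
  hR.rpow_const_of_ne fun y => (hpos y).ne'

theorem rpow_third_cube {x : ℝ} (hx : 0 ≤ x) : (x ^ (1 / 3 : ℝ)) ^ 3 = x := by
  rw [← Real.rpow_mul_natCast hx]
  norm_num

/-- A boundary profile for the cascade: `exp(-1/(1-z²))` is sent by the radial operator to a cube
`v³` near `z = 1`, and `v` in turn to `W (1-z²)` times a positive flat function. -/
theorem exists_boundary_profile (n : ℕ) {W : ℝ → ℝ} (hW : ContDiff ℝ ∞ W) (hW0 : 0 < W 0) :
    ∃ ε > 0, ∃ (q ρ : ℝ → ℝ), ContDiff ℝ ∞ q ∧ ContDiff ℝ ∞ ρ ∧ (∀ y, 0 < ρ y) ∧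
      (∀ z : ℝ, z ≠ 0 → 1 - z ^ 2 < ε →
        -(deriv (deriv fun z => flatGlue 1 0 1 (1 - z ^ 2)) z)
          - (n : ℝ) / z * deriv (fun z => flatGlue 1 0 1 (1 - z ^ 2)) z
          = flatGlue (1 / 3) (4 / 3) q (1 - z ^ 2) ^ 3) ∧
      (∀ z : ℝ, z ≠ 0 → 1 - z ^ 2 < ε →
        -(deriv (deriv fun z => flatGlue (1 / 3) (4 / 3) q (1 - z ^ 2)) z)
          - (n : ℝ) / z * deriv (fun z => flatGlue (1 / 3) (4 / 3) q (1 - z ^ 2)) z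
          = W (1 - z ^ 2) * flatGlue (1 / 3) (16 / 3) ρ (1 - z ^ 2)) := by
  have h1 : ContDiff ℝ ∞ (1 : ℝ → ℝ) := contDiff_const
  have hc1 := contDiff_flatRadialCoeff h1 n 1 0
  -- The coefficient at `0` is `-4`, so its negative is extended; the cube root `q = -Q^(1/3)` is
  -- therefore negative, and the second application of the operator makes the coefficient positive.
  obtain ⟨ε₁, hε₁, Q, hQ, hQpos, hQeq⟩ := exists_contDiff_pos_eqOn hc1.neg
    (by simp [flatRadialCoeff_zero])
  have hq : ContDiff ℝ ∞ fun y => -(Q y ^ (1 / 3 : ℝ)) := (contDiff_rpow_of_pos hQ hQpos _).neg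
  have hc2 := contDiff_flatRadialCoeff hq n (1 / 3) (4 / 3)
  obtain ⟨ε₂, hε₂, R, hR, hRpos, hReq⟩ := exists_contDiff_pos_eqOn hc2
    (by rw [flatRadialCoeff_zero]; have := Real.rpow_pos_of_pos (hQpos 0) (1 / 3); linarith)
  obtain ⟨ε₃, hε₃, V, hV, hVpos, hVeq⟩ := exists_contDiff_pos_eqOn hW hW0
  refine ⟨min ε₁ (min ε₂ ε₃), by positivity, _, fun y => R y / V y, hq,
    hR.div hV fun y => (hVpos y).ne', fun y => div_pos (hRpos y) (hVpos y), ?_, ?_⟩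
  · intro z hz hy
    rw [radial_operator_flatGlue one_pos 0 h1 n hz, flatGlue_cube]
    rcases le_or_gt (1 - z ^ 2) 0 with h | h
    · simp [flatGlue_of_nonpos h]
    rw [← abs_of_pos h] at hy
    have := hQeq _ (hy.trans_le (min_le_left _ _))
    simp only [flatGlue]
    norm_num
    congr 2
    rw [Odd.neg_pow (by decide), rpow_third_cube (hQpos _).le, this]
    simp
  · intro z hz hy
    rw [radial_operator_flatGlue (by norm_num) _ hq n hz]
    rcases le_or_gt (1 - z ^ 2) 0 with h | h
    · simp [flatGlue_of_nonpos h]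
    rw [← abs_of_pos h] at hy
    have e2 := hReq _ (hy.trans_le ((min_le_right _ _).trans (min_le_left _ _)))
    have e3 := hVeq _ (hy.trans_le ((min_le_right _ _).trans (min_le_right _ _)))
    have := (hVpos (1 - z ^ 2)).ne'
    simp only [flatGlue]
    rw [← e2, ← e3]
    norm_num
    split_ifs
    · field_simp
    · rfl

/-! ### Monotonicity and comparison of fluxes and potentials. -/

theorem radialFlux_zero (n : ℕ) (g : ℝ → ℝ) : radialFlux n g 0 = 0 := by simp [radialFlux]

theorem hasDerivAt_radialPotential_of_pos {n : ℕ} {g : ℝ → ℝ} (hg : Continuous g) {z : ℝ}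
    (hz : 0 < z) : HasDerivAt (radialPotential n g) (-(radialFlux n g z / z ^ n)) z := by
  refine (hasDerivAt_radialPotential hg z).congr_deriv ?_
  rw [← pow_mul_radialMean]
  field_simp
  ring

theorem continuous_radialFlux {g : ℝ → ℝ} (hg : Continuous g) (n : ℕ) :
    Continuous (radialFlux n g) :=
  continuous_iff_continuousAt.2 fun z => (hasDerivAt_radialFlux hg z).continuousAt

theorem radialFlux_mono {n : ℕ} {g : ℝ → ℝ} (hg : Continuous g) {s t : ℝ} (hs : 0 ≤ s)
    (h : ∀ x ∈ Set.Ioo s t, 0 ≤ g x) : MonotoneOn (radialFlux n g) (Set.Icc s t) := by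
  refine monotoneOn_of_deriv_nonneg (convex_Icc s t) (continuous_radialFlux hg n).continuousOn
    (fun x _ => (hasDerivAt_radialFlux hg x).differentiableAt.differentiableWithinAt) ?_
  intro x hx
  rw [interior_Icc] at hx
  rw [(hasDerivAt_radialFlux hg x).deriv]
  exact mul_nonneg (pow_nonneg (hs.trans hx.1.le) n) (h x hx)

theorem radialFlux_anti {n : ℕ} {g : ℝ → ℝ} (hg : Continuous g) {s t : ℝ} (hs : 0 ≤ s)
    (h : ∀ x ∈ Set.Ioo s t, g x ≤ 0) : AntitoneOn (radialFlux n g) (Set.Icc s t) := by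
  refine antitoneOn_of_deriv_nonpos (convex_Icc s t) (continuous_radialFlux hg n).continuousOn
    (fun x _ => (hasDerivAt_radialFlux hg x).differentiableAt.differentiableWithinAt) ?_
  intro x hx
  rw [interior_Icc] at hx
  rw [(hasDerivAt_radialFlux hg x).deriv]
  exact mul_nonpos_of_nonneg_of_nonpos (pow_nonneg (hs.trans hx.1.le) n) (h x hx)

theorem radialFlux_strictMono {n : ℕ} {g : ℝ → ℝ} (hg : Continuous g) {s t : ℝ} (hs : 0 ≤ s)
    (h : ∀ x ∈ Set.Ioo s t, 0 < g x) : StrictMonoOn (radialFlux n g) (Set.Icc s t) := by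
  refine strictMonoOn_of_deriv_pos (convex_Icc s t) (continuous_radialFlux hg n).continuousOn ?_
  intro x hx
  rw [interior_Icc] at hx
  rw [(hasDerivAt_radialFlux hg x).deriv]
  exact mul_pos (pow_pos (hs.trans_lt hx.1) n) (h x hx)

theorem radialFlux_strictAnti {n : ℕ} {g : ℝ → ℝ} (hg : Continuous g) {s t : ℝ} (hs : 0 ≤ s)
    (h : ∀ x ∈ Set.Ioo s t, g x < 0) : StrictAntiOn (radialFlux n g) (Set.Icc s t) := by
  refine strictAntiOn_of_deriv_neg (convex_Icc s t) (continuous_radialFlux hg n).continuousOn ?_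
  intro x hx
  rw [interior_Icc] at hx
  rw [(hasDerivAt_radialFlux hg x).deriv]
  exact mul_neg_of_pos_of_neg (pow_pos (hs.trans_lt hx.1) n) (h x hx)

theorem radialFlux_const {n : ℕ} {g : ℝ → ℝ} (hg : Continuous g) {s t : ℝ} (hs : 0 ≤ s)
    (h : ∀ x ∈ Set.Ioo s t, g x = 0) {x y : ℝ} (hx : x ∈ Set.Icc s t) (hy : y ∈ Set.Icc s t) :
    radialFlux n g x = radialFlux n g y := by
  have h1 := radialFlux_mono (n := n) hg hs fun x hx => (h x hx).ge
  have h2 := radialFlux_anti (n := n) hg hs fun x hx => (h x hx).le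
  rcases le_total x y with hxy | hxy
  · exact le_antisymm (h1 hx hy hxy) (h2 hx hy hxy)
  · exact le_antisymm (h2 hy hx hxy) (h1 hy hx hxy)

theorem radialPotential_anti {n : ℕ} {g : ℝ → ℝ} (hg : Continuous g) {s t : ℝ} (hs : 0 ≤ s)
    (h : ∀ x ∈ Set.Ioo s t, 0 ≤ radialFlux n g x) :
    AntitoneOn (radialPotential n g) (Set.Icc s t) := by
  refine antitoneOn_of_deriv_nonpos (convex_Icc s t)
    (continuous_radialPotential hg n).continuousOn
    (fun x _ => (hasDerivAt_radialPotential hg x).differentiableAt.differentiableWithinAt) ?_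
  intro x hx
  rw [interior_Icc] at hx
  have hx0 := hs.trans_lt hx.1
  rw [(hasDerivAt_radialPotential_of_pos hg hx0).deriv]
  exact neg_nonpos.2 (div_nonneg (h x hx) (pow_pos hx0 n).le)

theorem radialPotential_mono {n : ℕ} {g : ℝ → ℝ} (hg : Continuous g) {s t : ℝ} (hs : 0 ≤ s)
    (h : ∀ x ∈ Set.Ioo s t, radialFlux n g x ≤ 0) :
    MonotoneOn (radialPotential n g) (Set.Icc s t) := by
  refine monotoneOn_of_deriv_nonneg (convex_Icc s t)
    (continuous_radialPotential hg n).continuousOn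
    (fun x _ => (hasDerivAt_radialPotential hg x).differentiableAt.differentiableWithinAt) ?_
  intro x hx
  rw [interior_Icc] at hx
  have hx0 := hs.trans_lt hx.1
  rw [(hasDerivAt_radialPotential_of_pos hg hx0).deriv]
  exact neg_nonneg.2 (div_nonpos_of_nonpos_of_nonneg (h x hx) (pow_pos hx0 n).le)

theorem radialPotential_strictAnti {n : ℕ} {g : ℝ → ℝ} (hg : Continuous g) {s t : ℝ}
    (hs : 0 ≤ s) (h : ∀ x ∈ Set.Ioo s t, 0 < radialFlux n g x) :
    StrictAntiOn (radialPotential n g) (Set.Icc s t) := by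
  refine strictAntiOn_of_deriv_neg (convex_Icc s t)
    (continuous_radialPotential hg n).continuousOn ?_
  intro x hx
  rw [interior_Icc] at hx
  have hx0 := hs.trans_lt hx.1
  rw [(hasDerivAt_radialPotential_of_pos hg hx0).deriv]
  exact neg_neg_of_pos (div_pos (h x hx) (pow_pos hx0 n))

theorem radialPotential_strictMono {n : ℕ} {g : ℝ → ℝ} (hg : Continuous g) {s t : ℝ}
    (hs : 0 ≤ s) (h : ∀ x ∈ Set.Ioo s t, radialFlux n g x < 0) :
    StrictMonoOn (radialPotential n g) (Set.Icc s t) := by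
  refine strictMonoOn_of_deriv_pos (convex_Icc s t)
    (continuous_radialPotential hg n).continuousOn ?_
  intro x hx
  rw [interior_Icc] at hx
  have hx0 := hs.trans_lt hx.1
  rw [(hasDerivAt_radialPotential_of_pos hg hx0).deriv]
  exact neg_pos.2 (div_neg_of_neg_of_pos (h x hx) (pow_pos hx0 n))

/-- The potential `∫ᵣ¹ s⁻ⁿ ds` of a unit flux. -/
noncomputable def radialKernel (n : ℕ) (r : ℝ) : ℝ := ∫ s in r..1, (s ^ n)⁻¹

theorem hasDerivAt_radialKernel (n : ℕ) {r : ℝ} (hr : 0 < r) :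
    HasDerivAt (radialKernel n) (-(r ^ n)⁻¹) r := by
  have hc : ContinuousOn (fun s : ℝ => (s ^ n)⁻¹) (Set.Ioi 0) :=
    (continuous_pow n).continuousOn.inv₀ fun x hx => (pow_pos hx n).ne'
  refine intervalIntegral.integral_hasDerivAt_left ?_ ?_ ?_
  · refine (hc.mono fun x hx => ?_).intervalIntegrable
    exact (lt_min hr one_pos).trans_le hx.1
  · exact hc.stronglyMeasurableAtFilter isOpen_Ioi r hr
  · exact hc.continuousAt (Ioi_mem_nhds hr)

theorem radialKernel_one (n : ℕ) : radialKernel n 1 = 0 := by simp [radialKernel]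

theorem radialKernel_strictAnti (n : ℕ) : StrictAntiOn (radialKernel n) (Set.Ioi 0) := by
  refine strictAntiOn_of_deriv_neg (convex_Ioi 0)
    (fun r hr => (hasDerivAt_radialKernel n hr).continuousAt.continuousWithinAt) ?_
  intro r hr
  rw [interior_Ioi] at hr
  rw [(hasDerivAt_radialKernel n hr).deriv]
  exact neg_neg_of_pos (inv_pos.2 (pow_pos hr n))

/-- `X * radialKernel n` is the potential of the constant flux `X`, so a larger flux makes the
difference of potentials decreasing. -/
theorem le_radialPotential_sub {n : ℕ} {g : ℝ → ℝ} (hg : Continuous g) {s t X : ℝ} (hs : 0 < s)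
    (hst : s ≤ t) (h : ∀ x ∈ Set.Ioo s t, X ≤ radialFlux n g x) :
    X * (radialKernel n s - radialKernel n t) ≤ radialPotential n g s - radialPotential n g t := by
  have hD : ∀ x, 0 < x → HasDerivAt (fun x => radialPotential n g x - X * radialKernel n x)
      (-(radialFlux n g x / x ^ n) - X * -(x ^ n)⁻¹) x := fun x hx =>
    (hasDerivAt_radialPotential_of_pos hg hx).sub ((hasDerivAt_radialKernel n hx).const_mul X)
  have := antitoneOn_of_deriv_nonpos (convex_Icc s t)
    (fun x hx => (hD x (hs.trans_le hx.1)).continuousAt.continuousWithinAt)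
    (fun x hx => (hD x (hs.trans_le (interior_subset hx).1)).differentiableAt.differentiableWithinAt)
    (fun x hx => by
      rw [interior_Icc] at hx
      have hx0 := hs.trans hx.1
      rw [(hD x hx0).deriv]
      have := mul_le_mul_of_nonneg_right (h x hx) (inv_pos.2 (pow_pos hx0 n)).le
      rw [div_eq_mul_inv]
      linarith)
  have := this ⟨le_rfl, hst⟩ ⟨hst, le_rfl⟩ hst
  simp only at this
  linarith

theorem radialPotential_sub_le {n : ℕ} {g : ℝ → ℝ} (hg : Continuous g) {s t X : ℝ} (hs : 0 < s)
    (hst : s ≤ t) (h : ∀ x ∈ Set.Ioo s t, radialFlux n g x ≤ X) :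
    radialPotential n g s - radialPotential n g t ≤ X * (radialKernel n s - radialKernel n t) := by
  have hD : ∀ x, 0 < x → HasDerivAt (fun x => radialPotential n g x - X * radialKernel n x)
      (-(radialFlux n g x / x ^ n) - X * -(x ^ n)⁻¹) x := fun x hx =>
    (hasDerivAt_radialPotential_of_pos hg hx).sub ((hasDerivAt_radialKernel n hx).const_mul X)
  have := monotoneOn_of_deriv_nonneg (convex_Icc s t)
    (fun x hx => (hD x (hs.trans_le hx.1)).continuousAt.continuousWithinAt)
    (fun x hx => (hD x (hs.trans_le (interior_subset hx).1)).differentiableAt.differentiableWithinAt)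
    (fun x hx => by
      rw [interior_Icc] at hx
      have hx0 := hs.trans hx.1
      rw [(hD x hx0).deriv]
      have := mul_le_mul_of_nonneg_right (h x hx) (inv_pos.2 (pow_pos hx0 n)).le
      rw [div_eq_mul_inv]
      linarith)
  have := this ⟨le_rfl, hst⟩ ⟨hst, le_rfl⟩ hst
  simp only at this
  linarith

/-- Seen from radius `1/2`, a shell of radius `r ≥ 1/2` contributes its mass times the decreasing
kernel at `r`, so mass confined to radius `β` contributes at least the kernel at `β`. The next lemma
is the opposite bound for mass outside `α`. -/
theorem radialFlux_mul_kernel_le {n : ℕ} {g : ℝ → ℝ} (hg : Continuous g) {β : ℝ}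
    (hβ : 1 / 2 ≤ β) (hβ1 : β ≤ 1) (h0 : ∀ x ∈ Set.Icc (0 : ℝ) 1, 0 ≤ g x)
    (h1 : ∀ x ∈ Set.Icc β 1, g x = 0) :
    radialFlux n g 1 * radialKernel n β ≤ radialPotential n g (1 / 2) := by
  have hm := radialFlux_mono (n := n) hg le_rfl fun x hx => h0 x ⟨hx.1.le, hx.2.le⟩
  have e1 := radialPotential_anti (n := n) hg (s := 1 / 2) (t := β) (by norm_num) fun x hx => by
    have := hm ⟨le_rfl, zero_le_one⟩ ⟨by linarith [hx.1], hx.2.le.trans hβ1⟩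
      (by linarith [hx.1] : (0 : ℝ) ≤ x)
    rwa [radialFlux_zero] at this
  have e2 := le_radialPotential_sub (n := n) hg (by linarith : 0 < β) hβ1
    (X := radialFlux n g 1) fun x hx =>
      (radialFlux_const hg (by linarith) (fun y hy => h1 y ⟨hy.1.le, hy.2.le⟩)
        ⟨hβ1, le_rfl⟩ ⟨hx.1.le, hx.2.le⟩).le
  rw [radialKernel_one, radialPotential_one] at e2
  have := e1 ⟨le_rfl, hβ⟩ ⟨hβ, le_rfl⟩ hβ
  linarith

theorem radialPotential_le_flux_mul_kernel {n : ℕ} {g : ℝ → ℝ} (hg : Continuous g) {α : ℝ}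
    (hα : 1 / 2 ≤ α) (hα1 : α ≤ 1) (h0 : ∀ x ∈ Set.Icc (0 : ℝ) 1, 0 ≤ g x)
    (h1 : ∀ x ∈ Set.Icc 0 α, g x = 0) :
    radialPotential n g (1 / 2) ≤ radialFlux n g 1 * radialKernel n α := by
  have hm := radialFlux_mono (n := n) hg le_rfl fun x hx => h0 x ⟨hx.1.le, hx.2.le⟩
  have e1 := radialPotential_mono (n := n) hg (s := 1 / 2) (t := α) (by norm_num) fun x hx => by
    have := radialFlux_const (n := n) hg le_rfl (fun y hy => h1 y ⟨hy.1.le, hy.2.le⟩)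
      ⟨by linarith [hx.1], hx.2.le⟩ ⟨le_rfl, by linarith⟩
    rw [this, radialFlux_zero]
  have e2 := radialPotential_sub_le (n := n) hg (by linarith : 0 < α) hα1
    (X := radialFlux n g 1) fun x hx => hm ⟨by linarith [hx.1], hx.2.le⟩ ⟨zero_le_one, le_rfl⟩
      hx.2.le
  rw [radialKernel_one, radialPotential_one] at e2
  have := e1 ⟨le_rfl, hα⟩ ⟨hα, le_rfl⟩ hα
  linarith

theorem radialPotential_nonneg_of_pattern {n : ℕ} {g : ℝ → ℝ} (hg : Continuous g) {a : ℝ}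
    (ha : 1 / 2 ≤ a) (h1 : ∀ x ∈ Set.Icc 0 a, 0 ≤ g x) (hB : radialPotential n g (1 / 2) = 0)
    {z : ℝ} (hz : z ∈ Set.Icc (0 : ℝ) (1 / 2)) : 0 ≤ radialPotential n g z := by
  have hm := radialFlux_mono (n := n) hg le_rfl fun x hx => h1 x ⟨hx.1.le, hx.2.le⟩
  have := radialPotential_anti (n := n) hg (s := 0) (t := 1 / 2) le_rfl (fun x hx => by
    have := hm ⟨le_rfl, by linarith⟩ ⟨hx.1.le, by linarith [hx.2]⟩ hx.1.le
    rwa [radialFlux_zero] at this) hz ⟨by norm_num, le_rfl⟩ hz.2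
  linarith

/-- The flux rises from `0`, falls, and climbs back to `0` at `1`, so it changes sign once, from
nonnegative to nonpositive. The potential therefore first decreases from its zero at `1/2` and then
increases to its zero at `1`. -/
theorem radialPotential_nonpos_of_pattern {n : ℕ} {g : ℝ → ℝ} (hg : Continuous g) {a b : ℝ}
    (ha : 1 / 2 ≤ a) (hab : a ≤ b) (hb : b ≤ 1) (h1 : ∀ x ∈ Set.Icc 0 a, 0 ≤ g x)
    (h2 : ∀ x ∈ Set.Icc a b, g x ≤ 0) (h3 : ∀ x ∈ Set.Icc b 1, 0 ≤ g x)
    (hF : radialFlux n g 1 = 0) (hB : radialPotential n g (1 / 2) = 0)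
    {z : ℝ} (hz : z ∈ Set.Icc (1 / 2 : ℝ) 1) : radialPotential n g z ≤ 0 := by
  have m1 := radialFlux_mono (n := n) hg le_rfl fun x hx => h1 x ⟨hx.1.le, hx.2.le⟩
  have m2 := radialFlux_anti (n := n) hg (by linarith) fun x hx => h2 x ⟨hx.1.le, hx.2.le⟩
  have m3 := radialFlux_mono (n := n) hg (by linarith) fun x hx => h3 x ⟨hx.1.le, hx.2.le⟩
  have p1 : ∀ x ∈ Set.Icc 0 a, 0 ≤ radialFlux n g x := fun x hx => by
    have := m1 ⟨le_rfl, hx.1.trans hx.2⟩ hx hx.1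
    rwa [radialFlux_zero] at this
  have p3 : ∀ x ∈ Set.Icc b 1, radialFlux n g x ≤ 0 := fun x hx => by
    have := m3 hx ⟨hb, le_rfl⟩ hx.2
    rwa [hF] at this
  have left : (∀ x ∈ Set.Ioo (1 / 2) z, 0 ≤ radialFlux n g x) → radialPotential n g z ≤ 0 :=
    fun h => by
      have := radialPotential_anti hg (by norm_num) h ⟨le_rfl, hz.1⟩ ⟨hz.1, le_rfl⟩ hz.1
      rwa [hB] at this
  have right : (∀ x ∈ Set.Ioo z 1, radialFlux n g x ≤ 0) → radialPotential n g z ≤ 0 :=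
    fun h => by
      have := radialPotential_mono hg (by linarith [hz.1]) h ⟨le_rfl, hz.2⟩ ⟨hz.2, le_rfl⟩ hz.2
      rwa [radialPotential_one] at this
  rcases le_total z a with hza | hza
  · exact left fun x hx => p1 x ⟨by linarith [hx.1], hx.2.le.trans hza⟩
  rcases le_total b z with hzb | hzb
  · exact right fun x hx => p3 x ⟨hzb.trans hx.1.le, hx.2.le⟩
  -- Splitting on the sign of the flux at `z` itself avoids locating the crossing: a nonnegative
  -- value settles everything to the left, a nonpositive one everything to the right.
  rcases le_total 0 (radialFlux n g z) with h | h
  · refine left fun x hx => ?_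
    rcases le_total x a with hxa | hxa
    · exact p1 x ⟨by linarith [hx.1], hxa⟩
    · exact h.trans (m2 ⟨hxa, hx.2.le.trans hzb⟩ ⟨hza, hzb⟩ hx.2.le)
  · refine right fun x hx => ?_
    rcases le_total b x with hxb | hxb
    · exact p3 x ⟨hxb, hx.2.le⟩
    · exact (m2 ⟨hza, hzb⟩ ⟨hza.trans hx.1.le, hxb⟩ hx.1.le).trans h

theorem radialFlux_pos_of_pattern {n : ℕ} {g : ℝ → ℝ} (hg : Continuous g) {a : ℝ}
    (h1 : ∀ x ∈ Set.Ioo 0 a, 0 < g x) {x : ℝ} (hx : x ∈ Set.Ioc 0 a) : 0 < radialFlux n g x := by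
  have := radialFlux_strictMono (n := n) hg le_rfl h1 ⟨le_rfl, hx.1.le.trans hx.2⟩
    ⟨hx.1.le, hx.2⟩ hx.1
  rwa [radialFlux_zero] at this

theorem radialPotential_pos_of_pattern {n : ℕ} {g : ℝ → ℝ} (hg : Continuous g) {a : ℝ}
    (ha : 1 / 2 ≤ a) (h1 : ∀ x ∈ Set.Ioo 0 a, 0 < g x) (hB : radialPotential n g (1 / 2) = 0)
    {z : ℝ} (hz : z ∈ Set.Ico (0 : ℝ) (1 / 2)) : 0 < radialPotential n g z := by
  have := radialPotential_strictAnti (n := n) hg (s := 0) (t := 1 / 2) le_rfl (fun x hx =>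
    radialFlux_pos_of_pattern hg h1 ⟨hx.1, by linarith [hx.2]⟩) ⟨hz.1, hz.2.le⟩
    ⟨by norm_num, le_rfl⟩ hz.2
  linarith

theorem radialPotential_neg_of_pattern {n : ℕ} {g : ℝ → ℝ} (hg : Continuous g) {a b : ℝ}
    (ha : 1 / 2 ≤ a) (hab : a ≤ b) (hb : b ≤ 1) (h1 : ∀ x ∈ Set.Ioo 0 a, 0 < g x)
    (h2 : ∀ x ∈ Set.Ioo a b, g x < 0) (h3 : ∀ x ∈ Set.Ioo b 1, 0 < g x)
    (hF : radialFlux n g 1 = 0) (hB : radialPotential n g (1 / 2) = 0)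
    {z : ℝ} (hz : z ∈ Set.Ioo (1 / 2 : ℝ) 1) : radialPotential n g z < 0 := by
  have m2 := radialFlux_strictAnti (n := n) hg (by linarith) h2
  have m3 := radialFlux_strictMono (n := n) hg (by linarith) h3
  have p1 : ∀ x ∈ Set.Ioc 0 a, 0 < radialFlux n g x := fun x hx =>
    radialFlux_pos_of_pattern hg h1 hx
  have p3 : ∀ x ∈ Set.Ico b 1, radialFlux n g x < 0 := fun x hx => by
    have := m3 ⟨hx.1, hx.2.le⟩ ⟨hb, le_rfl⟩ hx.2
    rwa [hF] at this
  have left : (∀ x ∈ Set.Ioo (1 / 2) z, 0 < radialFlux n g x) → radialPotential n g z < 0 :=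
    fun h => by
      have := radialPotential_strictAnti hg (by norm_num) h ⟨le_rfl, hz.1.le⟩ ⟨hz.1.le, le_rfl⟩
        hz.1
      rwa [hB] at this
  have right : (∀ x ∈ Set.Ioo z 1, radialFlux n g x < 0) → radialPotential n g z < 0 :=
    fun h => by
      have := radialPotential_strictMono hg (by linarith [hz.1]) h ⟨le_rfl, hz.2.le⟩
        ⟨hz.2.le, le_rfl⟩ hz.2
      rwa [radialPotential_one] at this
  rcases le_total z a with hza | hza
  · exact left fun x hx => p1 x ⟨by linarith [hx.1], hx.2.le.trans hza⟩
  rcases le_total b z with hzb | hzb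
  · exact right fun x hx => p3 x ⟨hzb.trans hx.1.le, hx.2⟩
  rcases le_total 0 (radialFlux n g z) with h | h
  · refine left fun x hx => ?_
    rcases le_total x a with hxa | hxa
    · exact p1 x ⟨by linarith [hx.1], hxa⟩
    · exact h.trans_lt (m2 ⟨hxa, hx.2.le.trans hzb⟩ ⟨hza, hzb⟩ hx.2)
  · refine right fun x hx => ?_
    rcases le_total b x with hxb | hxb
    · exact p3 x ⟨hxb, hx.2⟩
    · exact (m2 ⟨hza, hzb⟩ ⟨hza.trans hx.1.le, hxb⟩ hx.1).trans_le h

/-! ### Bumps, the sign-changing weight, and the two linear moments. -/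

/-- A smooth even bump supported in the annulus `α ≤ |z| ≤ β`. -/
noncomputable def annularBump (α β z : ℝ) : ℝ := expNegInvGlue ((z ^ 2 - α ^ 2) * (β ^ 2 - z ^ 2))

/-- Nonnegative smooth even functions vanishing on `[d, ∞)`. -/
structure IsEvenBump (d : ℝ) (φ : ℝ → ℝ) : Prop where
  contDiff : ContDiff ℝ ∞ φ
  even : ∀ z, φ (-z) = φ z
  nonneg : ∀ z, 0 ≤ φ z
  eq_zero : ∀ z, d ≤ z → φ z = 0

theorem annularBump_pos {α β z : ℝ} (hα : 0 ≤ α) (h1 : α < z) (h2 : z < β) :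
    0 < annularBump α β z :=
  expNegInvGlue.pos_of_pos (mul_pos (by nlinarith) (by nlinarith))

theorem annularBump_eq_zero_of_le {α β z : ℝ} (hz : 0 ≤ z) (h1 : z ≤ α) (h2 : α ≤ β) :
    annularBump α β z = 0 :=
  expNegInvGlue.zero_of_nonpos (mul_nonpos_of_nonpos_of_nonneg (by nlinarith) (by nlinarith))

theorem annularBump_eq_zero_of_ge {α β z : ℝ} (hα : 0 ≤ α) (h1 : α ≤ β) (h2 : β ≤ z) :
    annularBump α β z = 0 :=
  expNegInvGlue.zero_of_nonpos (mul_nonpos_of_nonneg_of_nonpos (by nlinarith) (by nlinarith))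

theorem isEvenBump_annularBump {α β d : ℝ} (hα : 0 ≤ α) (h1 : α ≤ β) (h2 : β ≤ d) :
    IsEvenBump d (annularBump α β) where
  contDiff := expNegInvGlue.contDiff.comp (by fun_prop)
  even z := by simp [annularBump]
  nonneg z := expNegInvGlue.nonneg _
  eq_zero z hz := annularBump_eq_zero_of_ge hα h1 (h2.trans hz)

theorem IsEvenBump.add {d : ℝ} {φ ψ : ℝ → ℝ} (h1 : IsEvenBump d φ) (h2 : IsEvenBump d ψ) :
    IsEvenBump d fun z => φ z + ψ z where
  contDiff := h1.contDiff.add h2.contDiff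
  even z := by rw [h1.even, h2.even]
  nonneg z := add_nonneg (h1.nonneg z) (h2.nonneg z)
  eq_zero z hz := by rw [h1.eq_zero z hz, h2.eq_zero z hz, add_zero]

theorem IsEvenBump.const_mul {d c : ℝ} {φ : ℝ → ℝ} (h : IsEvenBump d φ) (hc : 0 ≤ c) :
    IsEvenBump d fun z => c * φ z where
  contDiff := contDiff_const.mul h.contDiff
  even z := by rw [h.even]
  nonneg z := mul_nonneg hc (h.nonneg z)
  eq_zero z hz := by rw [h.eq_zero z hz, mul_zero]

/-- A weight with zeros of order three at `±a` and `±b`. -/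
def cubicWeight (a b z : ℝ) : ℝ := ((z ^ 2 - a ^ 2) * (z ^ 2 - b ^ 2)) ^ 3

theorem contDiff_cubicWeight (a b : ℝ) : ContDiff ℝ ∞ (cubicWeight a b) := by
  unfold cubicWeight
  fun_prop

theorem cubicWeight_pos_of_lt {a b z : ℝ} (hz : 0 ≤ z) (h1 : z < a) (hab : a < b) :
    0 < cubicWeight a b z :=
  pow_pos (mul_pos_of_neg_of_neg (by nlinarith) (by nlinarith)) 3

theorem cubicWeight_neg {a b z : ℝ} (ha : 0 ≤ a) (h1 : a < z) (h2 : z < b) :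
    cubicWeight a b z < 0 :=
  Odd.pow_neg (by decide) (mul_neg_of_pos_of_neg (by nlinarith) (by nlinarith))

theorem cubicWeight_pos_of_gt {a b z : ℝ} (ha : 0 ≤ a) (hab : a < b) (h1 : b < z) :
    0 < cubicWeight a b z :=
  pow_pos (mul_pos (by nlinarith) (by nlinarith)) 3

theorem cubicWeight_left (a b : ℝ) : cubicWeight a b a = 0 := by simp [cubicWeight]

theorem cubicWeight_right (a b : ℝ) : cubicWeight a b b = 0 := by simp [cubicWeight]

theorem cubicWeight_nonneg_of_le {a b z : ℝ} (hz : 0 ≤ z) (h1 : z ≤ a) (hab : a < b) :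
    0 ≤ cubicWeight a b z := by
  rcases h1.lt_or_eq with h | rfl
  · exact (cubicWeight_pos_of_lt hz h hab).le
  · exact (cubicWeight_left _ _).ge

theorem cubicWeight_nonpos {a b z : ℝ} (ha : 0 ≤ a) (h1 : a ≤ z) (h2 : z ≤ b) :
    cubicWeight a b z ≤ 0 := by
  rcases h1.lt_or_eq with h | rfl
  · rcases h2.lt_or_eq with h' | rfl
    · exact (cubicWeight_neg ha h h').le
    · exact (cubicWeight_right _ _).le
  · exact (cubicWeight_left _ _).le

theorem cubicWeight_nonneg_of_ge {a b z : ℝ} (ha : 0 ≤ a) (hab : a < b) (h1 : b ≤ z) :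
    0 ≤ cubicWeight a b z := by
  rcases h1.lt_or_eq with h | rfl
  · exact (cubicWeight_pos_of_gt ha hab h).le
  · exact (cubicWeight_right _ _).ge

theorem radialFlux_neg_source (n : ℕ) (g : ℝ → ℝ) (z : ℝ) :
    radialFlux n (fun x => -g x) z = -radialFlux n g z := by
  simp [radialFlux]

theorem radialPotential_neg_source (n : ℕ) (g : ℝ → ℝ) (z : ℝ) :
    radialPotential n (fun x => -g x) z = -radialPotential n g z := by
  simp [radialPotential, radialMean]

theorem radialFlux_one_pos {n : ℕ} {g : ℝ → ℝ} (hg : Continuous g) {α β : ℝ} (hα : 0 ≤ α)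
    (hαβ : α < β) (hβ : β ≤ 1) (h0 : ∀ x ∈ Set.Icc (0 : ℝ) 1, 0 ≤ g x)
    (h1 : ∀ x ∈ Set.Ioo α β, 0 < g x) : 0 < radialFlux n g 1 := by
  have m := radialFlux_mono (n := n) hg le_rfl fun x hx => h0 x ⟨hx.1.le, hx.2.le⟩
  have e1 := m ⟨le_rfl, zero_le_one⟩ ⟨hα, by linarith⟩ hα
  have e2 := radialFlux_strictMono (n := n) hg hα h1 ⟨le_rfl, hαβ.le⟩ ⟨hαβ.le, le_rfl⟩ hαβ
  have e3 := m ⟨by linarith, hβ⟩ ⟨zero_le_one, le_rfl⟩ hβ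
  rw [radialFlux_zero] at e1
  linarith

/-- Three bumps adapted to the sign pattern of the weight whose moment vectors positively span the
plane. -/
theorem exists_spanning_bumps (n : ℕ) {a b α β : ℝ} (ha : 1 / 2 ≤ a) (hab : a < b) (hb : b < 1)
    (hα : 0 ≤ α) (hαβ : α < β) (hβ : β ≤ a) :
    ∃ φ₁ φ₂ φ₃ : ℝ → ℝ, (IsEvenBump ((1 + b) / 2) φ₁ ∧ IsEvenBump ((1 + b) / 2) φ₂ ∧
      IsEvenBump ((1 + b) / 2) φ₃) ∧ (∀ z ∈ Set.Ioo α β, 0 < φ₁ z) ∧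
      (∀ z ∈ Set.Icc 0 α, φ₁ z = 0) ∧ (∀ z ∈ Set.Icc β a, φ₁ z = 0) ∧
      (∀ z ∈ Set.Icc 0 a, φ₂ z = 0) ∧ (∀ z ∈ Set.Icc 0 a, φ₃ z = 0) ∧
      ∃ x₁ x₂ x₃ k₁ k₂ k₃ : ℝ,
        radialFlux n (fun z => cubicWeight a b z * φ₁ z) 1 = x₁ ∧
        radialFlux n (fun z => cubicWeight a b z * φ₂ z) 1 = x₂ ∧
        radialFlux n (fun z => cubicWeight a b z * φ₃ z) 1 = x₃ ∧
        radialPotential n (fun z => cubicWeight a b z * φ₁ z) (1 / 2) = k₁ ∧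
        radialPotential n (fun z => cubicWeight a b z * φ₂ z) (1 / 2) = k₂ ∧
        radialPotential n (fun z => cubicWeight a b z * φ₃ z) (1 / 2) = k₃ ∧
        0 < x₁ * k₂ - x₂ * k₁ ∧ 0 < x₂ * k₃ - x₃ * k₂ ∧ 0 < x₃ * k₁ - x₁ * k₃ := by
  -- The middle bump lives strictly inside `(a, b)`, leaving gaps on both sides so that the kernel
  -- comparisons below are strict.
  obtain ⟨a', ha', hab'⟩ := exists_between hab
  obtain ⟨b', hb', hbb'⟩ := exists_between hab'
  have ha0 : 0 ≤ a := by linarith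
  have b1 := isEvenBump_annularBump hα hαβ.le (show β ≤ (1 + b) / 2 by linarith)
  have b2 := isEvenBump_annularBump (show 0 ≤ a' by linarith) hb'.le
    (show b' ≤ (1 + b) / 2 by linarith)
  have b3 := isEvenBump_annularBump (show 0 ≤ b by linarith)
    (show b ≤ (1 + b) / 2 by linarith) le_rfl
  have hw := (contDiff_cubicWeight a b).continuous
  have c1 := hw.fun_mul b1.contDiff.continuous
  have c2 := (hw.fun_mul b2.contDiff.continuous).fun_neg
  have c3 := hw.fun_mul b3.contDiff.continuous
  have n1 : ∀ x ∈ Set.Icc (0 : ℝ) 1, 0 ≤ cubicWeight a b x * annularBump α β x := fun x hx => by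
    rcases le_total x a with h | h
    · exact mul_nonneg (cubicWeight_nonneg_of_le hx.1 h hab) (b1.nonneg x)
    · rw [annularBump_eq_zero_of_ge hα hαβ.le (hβ.trans h), mul_zero]
  have n2 : ∀ x ∈ Set.Icc (0 : ℝ) 1, 0 ≤ -(cubicWeight a b x * annularBump a' b' x) :=
    fun x hx => by
      rcases le_total x a' with h | h
      · rw [annularBump_eq_zero_of_le hx.1 h hb'.le, mul_zero, neg_zero]
      rcases le_total x b with h' | h'
      · exact neg_nonneg.2 (mul_nonpos_of_nonpos_of_nonneg
          (cubicWeight_nonpos ha0 (ha'.le.trans h) h') (b2.nonneg x))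
      · rw [annularBump_eq_zero_of_ge (by linarith) hb'.le (hbb'.le.trans h'), mul_zero, neg_zero]
  have n3 : ∀ x ∈ Set.Icc (0 : ℝ) 1, 0 ≤ cubicWeight a b x * annularBump b ((1 + b) / 2) x :=
    fun x hx => by
      rcases le_total x b with h | h
      · rw [annularBump_eq_zero_of_le hx.1 h (by linarith), mul_zero]
      · exact mul_nonneg (cubicWeight_nonneg_of_ge ha0 hab h) (b3.nonneg x)
  have p1 := radialFlux_one_pos (n := n) c1 hα hαβ (by linarith) n1 fun x hx =>
    mul_pos (cubicWeight_pos_of_lt (by linarith [hx.1]) (by linarith [hx.2]) hab)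
      (annularBump_pos hα hx.1 hx.2)
  have p2 := radialFlux_one_pos (n := n) c2 (show 0 ≤ a' by linarith) hb' (by linarith) n2
    fun x hx => neg_pos.2 (mul_neg_of_neg_of_pos
      (cubicWeight_neg ha0 (by linarith [hx.1]) (by linarith [hx.2]))
      (annularBump_pos (by linarith) hx.1 hx.2))
  have p3 := radialFlux_one_pos (n := n) c3 (show 0 ≤ b by linarith)
    (show b < (1 + b) / 2 by linarith) (by linarith) n3 fun x hx =>
    mul_pos (cubicWeight_pos_of_gt ha0 hab hx.1) (annularBump_pos (by linarith) hx.1 hx.2)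
  have q1 := radialFlux_mul_kernel_le (n := n) c1 ha (by linarith) n1 fun x hx => by
    show cubicWeight a b x * annularBump α β x = 0
    rw [annularBump_eq_zero_of_ge hα hαβ.le (hβ.trans hx.1), mul_zero]
  have q2 := radialFlux_mul_kernel_le (n := n) c2 (show 1 / 2 ≤ b' by linarith) (by linarith) n2
    fun x hx => by
      show -(cubicWeight a b x * annularBump a' b' x) = 0
      rw [annularBump_eq_zero_of_ge (by linarith) hb'.le hx.1, mul_zero, neg_zero]
  have q2' := radialPotential_le_flux_mul_kernel (n := n) c2 (show 1 / 2 ≤ a' by linarith)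
    (by linarith) n2 fun x hx => by
      show -(cubicWeight a b x * annularBump a' b' x) = 0
      rw [annularBump_eq_zero_of_le hx.1 hx.2 hb'.le, mul_zero, neg_zero]
  have q3 := radialPotential_le_flux_mul_kernel (n := n) c3 (show 1 / 2 ≤ b by linarith)
    (by linarith) n3 fun x hx => by
      show cubicWeight a b x * annularBump b ((1 + b) / 2) x = 0
      rw [annularBump_eq_zero_of_le hx.1 hx.2 (by linarith), mul_zero]
  have A := radialKernel_strictAnti n
  have κ1 := A (show a ∈ Set.Ioi (0 : ℝ) by simp; linarith)
    (show a' ∈ Set.Ioi (0 : ℝ) by simp; linarith) ha'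
  have κ2 := A (show b' ∈ Set.Ioi (0 : ℝ) by simp; linarith)
    (show b ∈ Set.Ioi (0 : ℝ) by simp; linarith) hbb'
  have κ3 := A (show a ∈ Set.Ioi (0 : ℝ) by simp; linarith)
    (show b ∈ Set.Ioi (0 : ℝ) by simp; linarith) hab
  refine ⟨_, _, _, ⟨b1, b2, b3⟩, fun z hz => annularBump_pos hα hz.1 hz.2,
    fun z hz => annularBump_eq_zero_of_le hz.1 hz.2 hαβ.le,
    fun z hz => annularBump_eq_zero_of_ge hα hαβ.le hz.1,
    fun z hz => annularBump_eq_zero_of_le hz.1 (hz.2.trans ha'.le) hb'.le,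
    fun z hz => annularBump_eq_zero_of_le hz.1 (hz.2.trans hab.le) (by linarith),
    _, _, _, _, _, _, rfl, rfl, rfl, rfl, rfl, rfl, ?_⟩
  -- The ratios of potential to flux for the three bumps are strictly decreasing, separated by
  -- kernel values, while the fluxes have signs +, -, +. This orientation makes all three
  -- determinants positive.
  rw [radialFlux_neg_source] at p2 q2 q2'
  rw [radialPotential_neg_source] at q2 q2'
  generalize radialFlux n (fun z => cubicWeight a b z * annularBump a' b' z) 1 = x₂ at *
  generalize radialFlux n (fun z => cubicWeight a b z * annularBump α β z) 1 = x₁ at *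
  generalize radialFlux n (fun z => cubicWeight a b z * annularBump b ((1 + b) / 2) z) 1 = x₃ at *
  generalize radialPotential n (fun z => cubicWeight a b z * annularBump α β z) (1 / 2) = k₁ at *
  generalize radialPotential n (fun z => cubicWeight a b z * annularBump a' b' z) (1 / 2) = k₂ at *
  generalize radialPotential n (fun z => cubicWeight a b z * annularBump b ((1 + b) / 2) z) (1 / 2)
    = k₃ at *
  generalize radialKernel n a = κa at *
  generalize radialKernel n a' = κa' at *
  generalize radialKernel n b = κb at *
  generalize radialKernel n b' = κb' at *
  refine ⟨?_, ?_, ?_⟩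
  · have e1 := mul_le_mul_of_nonneg_left q1 p2.le
    have e2 := mul_le_mul_of_nonneg_left q2' p1.le
    have e3 := mul_lt_mul_of_pos_left κ1 (mul_pos p1 p2)
    linarith
  · have e1 := mul_le_mul_of_nonneg_left q3 p2.le
    have e2 := mul_le_mul_of_nonneg_left q2 p3.le
    have e3 := mul_lt_mul_of_pos_left κ2 (mul_pos p3 p2)
    linarith
  · have e1 := mul_le_mul_of_nonneg_left q1 p3.le
    have e2 := mul_le_mul_of_nonneg_left q3 p1.le
    have e3 := mul_lt_mul_of_pos_left κ3 (mul_pos p1 p3)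
    linarith

/-- The three determinants are the coefficients of a positive linear relation between the vectors.
Solve with the first two vectors by Cramer's rule (`m₁`, `m₂`), then add `s + t` times the relation
to make every coefficient nonnegative. -/
theorem exists_nonneg_combination {x₁ x₂ x₃ k₁ k₂ k₃ : ℝ} (h12 : 0 < x₁ * k₂ - x₂ * k₁)
    (h23 : 0 < x₂ * k₃ - x₃ * k₂) (h31 : 0 < x₃ * k₁ - x₁ * k₃) (X K : ℝ) :
    ∃ c₁ c₂ c₃ : ℝ, 0 ≤ c₁ ∧ 0 ≤ c₂ ∧ 0 ≤ c₃ ∧ X + c₁ * x₁ + c₂ * x₂ + c₃ * x₃ = 0 ∧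
      K + c₁ * k₁ + c₂ * k₂ + c₃ * k₃ = 0 := by
  obtain ⟨m₁, hm₁⟩ : ∃ m, m * (x₁ * k₂ - x₂ * k₁) = -X * k₂ + K * x₂ :=
    ⟨_, div_mul_cancel₀ _ h12.ne'⟩
  obtain ⟨m₂, hm₂⟩ : ∃ m, m * (x₁ * k₂ - x₂ * k₁) = -x₁ * K + k₁ * X :=
    ⟨_, div_mul_cancel₀ _ h12.ne'⟩
  obtain ⟨s, hs⟩ : ∃ s, s * (x₂ * k₃ - x₃ * k₂) = |m₁| := ⟨_, div_mul_cancel₀ _ h23.ne'⟩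
  obtain ⟨t, ht⟩ : ∃ t, t * (x₃ * k₁ - x₁ * k₃) = |m₂| := ⟨_, div_mul_cancel₀ _ h31.ne'⟩
  have hs0 : 0 ≤ s := nonneg_of_mul_nonneg_left (hs ▸ abs_nonneg m₁) h23
  have ht0 : 0 ≤ t := nonneg_of_mul_nonneg_left (ht ▸ abs_nonneg m₂) h31
  refine ⟨m₁ + (s + t) * (x₂ * k₃ - x₃ * k₂), m₂ + (s + t) * (x₃ * k₁ - x₁ * k₃),
    (s + t) * (x₁ * k₂ - x₂ * k₁), ?_, ?_, by positivity, ?_, ?_⟩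
  · have := mul_nonneg ht0 h23.le
    have := neg_abs_le m₁
    linarith
  · have := mul_nonneg hs0 h31.le
    have := neg_abs_le m₂
    linarith
  · apply mul_right_cancel₀ h12.ne'
    linear_combination x₁ * hm₁ + x₂ * hm₂
  · apply mul_right_cancel₀ h12.ne'
    linear_combination k₁ * hm₁ + k₂ * hm₂

theorem moments_combination {n : ℕ} {w g φ₁ φ₂ φ₃ : ℝ → ℝ} (hw : Continuous w)
    (hg : Continuous g) (h1 : Continuous φ₁) (h2 : Continuous φ₂) (h3 : Continuous φ₃)
    (c₁ c₂ c₃ z : ℝ) :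
    radialFlux n (fun z => g z + w z * (c₁ * φ₁ z + c₂ * φ₂ z + c₃ * φ₃ z)) z
        = radialFlux n g z + c₁ * radialFlux n (fun z => w z * φ₁ z) z
          + c₂ * radialFlux n (fun z => w z * φ₂ z) z
          + c₃ * radialFlux n (fun z => w z * φ₃ z) z ∧
    radialPotential n (fun z => g z + w z * (c₁ * φ₁ z + c₂ * φ₂ z + c₃ * φ₃ z)) z
        = radialPotential n g z + c₁ * radialPotential n (fun z => w z * φ₁ z) z
          + c₂ * radialPotential n (fun z => w z * φ₂ z) z
          + c₃ * radialPotential n (fun z => w z * φ₃ z) z := by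
  have e : (fun z => g z + w z * (c₁ * φ₁ z + c₂ * φ₂ z + c₃ * φ₃ z)) = fun z =>
      (g z + c₁ * (w z * φ₁ z) + c₂ * (w z * φ₂ z)) + c₃ * (w z * φ₃ z) := by ext; ring
  rw [e]
  constructor
  · rw [radialFlux_add_smul (by fun_prop) (by fun_prop),
      radialFlux_add_smul (by fun_prop) (by fun_prop),
      radialFlux_add_smul (by fun_prop) (by fun_prop)]
  · rw [radialPotential_add_smul (by fun_prop) (by fun_prop),
      radialPotential_add_smul (by fun_prop) (by fun_prop),
      radialPotential_add_smul (by fun_prop) (by fun_prop)]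

theorem exists_balancing_bump (n : ℕ) {a b : ℝ} (ha : 1 / 2 ≤ a) (hab : a < b) (hb : b < 1)
    {g : ℝ → ℝ} (hg : Continuous g) :
    ∃ q : ℝ → ℝ, IsEvenBump ((1 + b) / 2) q ∧
      radialFlux n (fun z => g z + cubicWeight a b z * q z) 1 = 0 ∧
      radialPotential n (fun z => g z + cubicWeight a b z * q z) (1 / 2) = 0 := by
  obtain ⟨φ₁, φ₂, φ₃, ⟨b1, b2, b3⟩, -, -, -, -, -, x₁, x₂, x₃, k₁, k₂, k₃, hx1, hx2, hx3,
    hk1, hk2, hk3, h12, h23, h31⟩ := exists_spanning_bumps n ha hab hb le_rfl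
      (show (0 : ℝ) < a by linarith) le_rfl
  obtain ⟨c₁, c₂, c₃, h1, h2, h3, hX, hK⟩ := exists_nonneg_combination h12 h23 h31
    (radialFlux n g 1) (radialPotential n g (1 / 2))
  have hm := moments_combination (n := n) (contDiff_cubicWeight a b).continuous hg
    b1.contDiff.continuous b2.contDiff.continuous b3.contDiff.continuous c₁ c₂ c₃
  refine ⟨_, ((b1.const_mul h1).add (b2.const_mul h2)).add (b3.const_mul h3), ?_, ?_⟩
  · rw [(hm 1).1, hx1, hx2, hx3, hX]
  · rw [(hm (1 / 2)).2, hk1, hk2, hk3, hK]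

/-- The positive relation itself, with the determinants as coefficients, kills both moments. The
part inside radius `a` lies in the annulus from `α` to `β`, whose free choice governs the sign of
the cubic moment. -/
theorem exists_balanced_bump (n : ℕ) {a b α β : ℝ} (ha : 1 / 2 ≤ a) (hab : a < b) (hb : b < 1)
    (hα : 0 ≤ α) (hαβ : α < β) (hβ : β ≤ a) :
    ∃ q : ℝ → ℝ, IsEvenBump ((1 + b) / 2) q ∧ (∀ z ∈ Set.Ioo α β, 0 < q z) ∧
      (∀ z ∈ Set.Icc 0 α, q z = 0) ∧ (∀ z ∈ Set.Icc β a, q z = 0) ∧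
      radialFlux n (fun z => cubicWeight a b z * q z) 1 = 0 ∧
      radialPotential n (fun z => cubicWeight a b z * q z) (1 / 2) = 0 := by
  obtain ⟨φ₁, φ₂, φ₃, ⟨b1, b2, b3⟩, p, z1, z1', z2, z3, x₁, x₂, x₃, k₁, k₂, k₃, hx1, hx2, hx3,
    hk1, hk2, hk3, h12, h23, h31⟩ := exists_spanning_bumps n ha hab hb hα hαβ hβ
  have hm := moments_combination (n := n) (g := fun _ => 0) (contDiff_cubicWeight a b).continuous
    continuous_const b1.contDiff.continuous b2.contDiff.continuous b3.contDiff.continuous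
    (x₂ * k₃ - x₃ * k₂) (x₃ * k₁ - x₁ * k₃) (x₁ * k₂ - x₂ * k₁)
  have f0 : ∀ z, radialFlux n (fun _ => 0) z = 0 := fun z => by simp [radialFlux]
  have p0 : ∀ z, radialPotential n (fun _ => 0) z = 0 := fun z => by
    simp [radialPotential, radialMean]
  simp only [zero_add, f0, p0] at hm
  refine ⟨_, ((b1.const_mul h23.le).add (b2.const_mul h31.le)).add (b3.const_mul h12.le),
    fun z hz => ?_, fun z hz => ?_, fun z hz => ?_, ?_, ?_⟩
  · have := mul_pos h23 (p z hz)
    have := mul_nonneg h31.le (b2.nonneg z)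
    have := mul_nonneg h12.le (b3.nonneg z)
    linarith
  · have hz' : z ∈ Set.Icc 0 a := ⟨hz.1, by linarith [hz.2]⟩
    rw [z1 z hz, z2 z hz', z3 z hz']; ring
  · have hz' : z ∈ Set.Icc 0 a := ⟨by linarith [hz.1], hz.2⟩
    rw [z1' z hz, z2 z hz', z3 z hz']; ring
  · rw [(hm 1).1, hx1, hx2, hx3]; ring
  · rw [(hm (1 / 2)).2, hk1, hk2, hk3]; ring

/-! ### The cubic moment. -/

/-- The total flux of the cube of the potential. -/
noncomputable def cubicMoment (n : ℕ) (g : ℝ → ℝ) : ℝ :=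
  radialFlux n (fun z => radialPotential n g z ^ 3) 1

theorem exists_nonneg_root_cubic {f : ℝ → ℝ} {c₀ c₁ c₂ c₃ : ℝ}
    (hf : ∀ t, f t = c₀ + c₁ * t + c₂ * t ^ 2 + c₃ * t ^ 3) (h0 : c₀ ≤ 0) (h3 : 0 < c₃) :
    ∃ t, 0 ≤ t ∧ f t = 0 := by
  set S := |c₀| + |c₁| + |c₂| with hS
  have hS0 : 0 ≤ S := by positivity
  -- At this `T ≥ 1` the leading term is at least `S * T ^ 2`, which dominates the lower-order
  -- terms.
  set T := 1 + S / c₃ with hT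
  have hT1 : 1 ≤ T := by
    have := div_nonneg hS0 h3.le
    linarith
  have hT3 : c₃ * T = c₃ + S := by rw [hT]; field_simp
  have hcont : Continuous f := by rw [funext hf]; fun_prop
  have hfT : 0 ≤ f T := by
    have e0 : -|c₀| * T ^ 2 ≤ c₀ := by
      have := mul_le_mul_of_nonneg_left (one_le_pow₀ hT1 : 1 ≤ T ^ 2) (abs_nonneg c₀)
      linarith [neg_abs_le c₀]
    have e1 : -|c₁| * T ^ 2 ≤ c₁ * T := by
      nlinarith [mul_le_mul_of_nonneg_right (neg_abs_le c₁) (zero_le_one.trans hT1),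
        mul_nonneg (abs_nonneg c₁) (mul_nonneg (zero_le_one.trans hT1) (sub_nonneg.2 hT1))]
    have e2 : -|c₂| * T ^ 2 ≤ c₂ * T ^ 2 :=
      mul_le_mul_of_nonneg_right (neg_abs_le c₂) (sq_nonneg T)
    have e3 : c₃ * T ^ 3 = (c₃ + S) * T ^ 2 := by rw [← hT3]; ring
    have e4 : 0 ≤ c₃ * T ^ 2 := by positivity
    rw [hf, e3, hS]
    linarith
  have hf0 : f 0 ≤ 0 := by rw [hf]; linarith
  obtain ⟨t, ht, h⟩ := intermediate_value_Icc (zero_le_one.trans hT1) hcont.continuousOn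
    ⟨hf0, hfT⟩
  exact ⟨t, ht.1, h⟩

theorem cubicMoment_add_smul {n : ℕ} {g h : ℝ → ℝ} (hg : Continuous g) (hh : Continuous h) :
    ∃ c₁ c₂ : ℝ, ∀ t : ℝ, cubicMoment n (fun z => g z + t * h z)
      = cubicMoment n g + c₁ * t + c₂ * t ^ 2 + cubicMoment n h * t ^ 3 := by
  have hu := continuous_radialPotential hg n
  have hv := continuous_radialPotential hh n
  refine ⟨3 * radialFlux n (fun z => radialPotential n g z ^ 2 * radialPotential n h z) 1,
    3 * radialFlux n (fun z => radialPotential n g z * radialPotential n h z ^ 2) 1, fun t => ?_⟩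
  have e : (fun z => radialPotential n (fun z => g z + t * h z) z ^ 3) = fun z =>
      ((radialPotential n g z ^ 3
        + (3 * t) * (radialPotential n g z ^ 2 * radialPotential n h z))
        + (3 * t ^ 2) * (radialPotential n g z * radialPotential n h z ^ 2))
        + t ^ 3 * radialPotential n h z ^ 3 := by
    ext z
    rw [radialPotential_add_smul hg hh]
    ring
  simp only [cubicMoment]
  rw [e, radialFlux_add_smul (by fun_prop) (by fun_prop),
    radialFlux_add_smul (by fun_prop) (by fun_prop),
    radialFlux_add_smul (by fun_prop) (by fun_prop)]
  ring

/-- Along a ray the moment is a cubic polynomial whose leading coefficient is the moment of the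
direction. Choosing that sign opposite to the initial value gives a root with `t ≥ 0`, which keeps
the added bump nonnegative. -/
theorem exists_cubicMoment_eq_zero {n : ℕ} {g h₁ h₂ : ℝ → ℝ} (hg : Continuous g)
    (hh₁ : Continuous h₁) (hh₂ : Continuous h₂) (hpos : 0 < cubicMoment n h₁)
    (hneg : cubicMoment n h₂ < 0) :
    ∃ t, 0 ≤ t ∧ (cubicMoment n (fun z => g z + t * h₁ z) = 0 ∨
      cubicMoment n (fun z => g z + t * h₂ z) = 0) := by
  rcases le_total (cubicMoment n g) 0 with h | h
  · obtain ⟨c₁, c₂, hc⟩ := cubicMoment_add_smul (n := n) hg hh₁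
    obtain ⟨t, ht, e⟩ := exists_nonneg_root_cubic hc h hpos
    exact ⟨t, ht, Or.inl e⟩
  · obtain ⟨c₁, c₂, hc⟩ := cubicMoment_add_smul (n := n) hg hh₂
    obtain ⟨t, ht, e⟩ := exists_nonneg_root_cubic
      (f := fun t => -cubicMoment n (fun z => g z + t * h₂ z))
      (c₀ := -cubicMoment n g) (c₁ := -c₁) (c₂ := -c₂) (c₃ := -cubicMoment n h₂)
      (fun t => by rw [hc]; ring) (neg_nonpos.2 h) (neg_pos.2 hneg)
    exact ⟨t, ht, Or.inr (neg_eq_zero.1 e)⟩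

theorem exists_radialPotential_ne_zero {n : ℕ} {g : ℝ → ℝ} (hg : ContDiff ℝ ∞ g) {x : ℝ}
    (hx : x ∈ Set.Ioo (0 : ℝ) 1) (hgx : g x ≠ 0) :
    ∃ z ∈ Set.Ioo (0 : ℝ) 1, radialPotential n g z ≠ 0 := by
  by_contra! h
  have h0 : radialPotential n g =ᶠ[nhds x] fun _ => 0 := by
    filter_upwards [isOpen_Ioo.mem_nhds hx] with z hz using h z hz
  have := radialPotential_equation hg n hx.1.ne'
  rw [h0.deriv.deriv_eq, h0.deriv_eq] at this
  simp at this
  exact hgx this.symm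

/-- Put the inner mass in `(1/2, a)`: there is no flux up to `1/2`, so the potential is zero there,
and it is nonpositive afterwards without vanishing identically. -/
theorem exists_bump_cubicMoment_neg (n : ℕ) {a b : ℝ} (ha : 1 / 2 < a) (hab : a < b)
    (hb : b < 1) :
    ∃ q : ℝ → ℝ, IsEvenBump ((1 + b) / 2) q ∧
      radialFlux n (fun z => cubicWeight a b z * q z) 1 = 0 ∧
      radialPotential n (fun z => cubicWeight a b z * q z) (1 / 2) = 0 ∧
      cubicMoment n (fun z => cubicWeight a b z * q z) < 0 := by
  obtain ⟨q, hq, hpos, hz1, -, hF, hB⟩ := exists_balanced_bump n ha.le hab hb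
    (show (0 : ℝ) ≤ 1 / 2 by norm_num) ha le_rfl
  refine ⟨q, hq, hF, hB, ?_⟩
  have ha0 : 0 ≤ a := by linarith
  have hg : ContDiff ℝ ∞ fun z => cubicWeight a b z * q z :=
    (contDiff_cubicWeight a b).mul hq.contDiff
  have hle : ∀ z ∈ Set.Icc (0 : ℝ) 1,
      radialPotential n (fun z => cubicWeight a b z * q z) z ≤ 0 := by
    intro z hz
    rcases le_total z (1 / 2) with h | h
    · have hm := radialPotential_mono (n := n) hg.continuous (s := 0) (t := 1 / 2) le_rfl
        (fun x hx => by
          rw [radialFlux_const (n := n) hg.continuous (s := 0) (t := 1 / 2) le_rfl (fun y hy => by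
            rw [hz1 y ⟨hy.1.le, hy.2.le⟩, mul_zero]) ⟨hx.1.le, hx.2.le⟩ ⟨le_rfl, by norm_num⟩,
            radialFlux_zero]) ⟨hz.1, h⟩ ⟨by norm_num, le_rfl⟩ h
      rwa [hB] at hm
    · exact radialPotential_nonpos_of_pattern hg.continuous ha.le hab.le hb.le
        (fun x hx => mul_nonneg (cubicWeight_nonneg_of_le hx.1 hx.2 hab) (hq.nonneg x))
        (fun x hx => mul_nonpos_of_nonpos_of_nonneg (cubicWeight_nonpos ha0 hx.1 hx.2)
          (hq.nonneg x))
        (fun x hx => mul_nonneg (cubicWeight_nonneg_of_ge ha0 hab hx.1) (hq.nonneg x))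
        hF hB ⟨h, hz.2⟩
  obtain ⟨x, hx, hx'⟩ := exists_between ha
  obtain ⟨z, hz, hne⟩ := exists_radialPotential_ne_zero (n := n) hg (x := x)
    ⟨by linarith, by linarith⟩ (mul_ne_zero
      (cubicWeight_pos_of_lt (by linarith) hx' hab).ne' (hpos x ⟨hx, hx'⟩).ne')
  have hc := continuous_radialPotential hg.continuous n
  have hint : 0 < ∫ s in (0 : ℝ)..1,
      -(s ^ n * radialPotential n (fun z => cubicWeight a b z * q z) s ^ 3) := by
    refine intervalIntegral.integral_pos zero_lt_one (by fun_prop) (fun s hs => ?_)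
      ⟨z, ⟨hz.1.le, hz.2.le⟩, ?_⟩
    · exact neg_nonneg.2 (mul_nonpos_of_nonneg_of_nonpos (pow_nonneg hs.1.le n)
        (Odd.pow_nonpos (by decide) (hle s ⟨hs.1.le, hs.2⟩)))
    · exact neg_pos.2 (mul_neg_of_pos_of_neg (pow_pos hz.1 n)
        (Odd.pow_neg (by decide) (lt_of_le_of_ne (hle z ⟨hz.1.le, hz.2.le⟩) hne)))
  rw [intervalIntegral.integral_neg] at hint
  exact neg_pos.1 hint

/-- Put the inner mass in `(0, 1/4)`: the potential is at least linear in the distance to `1/2` on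
`[1/4, 1/2]`. Past `1/2` it can decrease only up to `b`, so its negative part is small when `b` is
close to `1/2`. -/
theorem exists_bump_cubicMoment_pos (n : ℕ) {a b : ℝ} (ha : 1 / 2 < a) (hab : a < b)
    (hb : b ≤ 1 / 2 + (1 / 4) ^ (n + 1) / 8) :
    ∃ q : ℝ → ℝ, IsEvenBump ((1 + b) / 2) q ∧
      radialFlux n (fun z => cubicWeight a b z * q z) 1 = 0 ∧
      radialPotential n (fun z => cubicWeight a b z * q z) (1 / 2) = 0 ∧
      0 < cubicMoment n (fun z => cubicWeight a b z * q z) := by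
  have hη1 : ((1 : ℝ) / 4) ^ (n + 1) ≤ 1 := pow_le_one₀ (by norm_num) (by norm_num)
  have hη0 : (0 : ℝ) < (1 / 4) ^ (n + 1) := by positivity
  have hb1 : b < 1 := by linarith
  have ha0 : 0 ≤ a := by linarith
  obtain ⟨q, hq, hpos, -, hz1, hF, hB⟩ := exists_balanced_bump n ha.le hab hb1
    le_rfl (show (0 : ℝ) < 1 / 4 by norm_num) (by linarith)
  refine ⟨q, hq, hF, hB, ?_⟩
  have hg : Continuous fun z => cubicWeight a b z * q z :=
    ((contDiff_cubicWeight a b).mul hq.contDiff).continuous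
  have g1 : ∀ x ∈ Set.Icc 0 a, 0 ≤ cubicWeight a b x * q x := fun x hx =>
    mul_nonneg (cubicWeight_nonneg_of_le hx.1 hx.2 hab) (hq.nonneg x)
  have g2 : ∀ x ∈ Set.Icc a b, cubicWeight a b x * q x ≤ 0 := fun x hx =>
    mul_nonpos_of_nonpos_of_nonneg (cubicWeight_nonpos ha0 hx.1 hx.2) (hq.nonneg x)
  have g3 : ∀ x ∈ Set.Icc b 1, 0 ≤ cubicWeight a b x * q x := fun x hx =>
    mul_nonneg (cubicWeight_nonneg_of_ge ha0 hab hx.1) (hq.nonneg x)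
  have g0 : ∀ x ∈ Set.Icc (1 / 4) a, cubicWeight a b x * q x = 0 := fun x hx => by
    rw [hz1 x hx, mul_zero]
  have hX := radialFlux_pos_of_pattern (n := n) hg (a := 1 / 4) (fun x hx =>
    mul_pos (cubicWeight_pos_of_lt hx.1.le (by linarith [hx.2]) hab) (hpos x hx))
    (x := 1 / 4) ⟨by norm_num, le_rfl⟩
  have hnn := fun z (hz : z ∈ Set.Icc (0 : ℝ) (1 / 2)) =>
    radialPotential_nonneg_of_pattern (n := n) hg ha.le g1 hB hz
  set g := fun z => cubicWeight a b z * q z with hgdef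
  set X := radialFlux n g (1 / 4) with hXdef
  have fX : ∀ x ∈ Set.Icc (1 / 4) a, radialFlux n g x = X := fun x hx =>
    radialFlux_const hg (by norm_num) (fun y hy => g0 y ⟨hy.1.le, hy.2.le⟩) hx
      ⟨le_rfl, by linarith⟩
  have fle : ∀ x ∈ Set.Icc (1 / 4) b, radialFlux n g x ≤ X := fun x hx => by
    rcases le_total x a with h | h
    · exact (fX x ⟨hx.1, h⟩).le
    · rw [← fX a ⟨by linarith, le_rfl⟩]
      exact radialFlux_anti hg ha0 (fun y hy => g2 y ⟨hy.1.le, hy.2.le⟩) ⟨le_rfl, hab.le⟩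
        ⟨h, hx.2⟩ h
  have fneg : ∀ x ∈ Set.Icc b 1, radialFlux n g x ≤ 0 := fun x hx => by
    rw [← hF]
    exact radialFlux_mono hg (by linarith) (fun y hy => g3 y ⟨hy.1.le, hy.2.le⟩) hx
      ⟨hb1.le, le_rfl⟩ hx.2
  -- `Y` is the slope, up to sign, that the flux `X` produces at radius `1/2`. The potential is
  -- steeper than `Y` before `1/2`, and falls no faster than `Y` between `1/2` and `b`.
  set Y := X * 2 ^ n with hY
  have hY0 : 0 < Y := by positivity
  have hD : ∀ x, 0 < x → HasDerivAt (fun x => radialPotential n g x + Y * x)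
      (-(radialFlux n g x / x ^ n) + Y * 1) x := fun x hx =>
    (hasDerivAt_radialPotential_of_pos hg hx).add ((hasDerivAt_id x).const_mul Y)
  have hpow : ∀ x : ℝ, x ^ n * 2 ^ n = (2 * x) ^ n := fun x => by
    rw [mul_pow, mul_comm]
  have hlow : ∀ z ∈ Set.Icc (1 / 4 : ℝ) (1 / 2), Y * (1 / 2 - z) ≤ radialPotential n g z := by
    intro z hz
    have := antitoneOn_of_deriv_nonpos (convex_Icc (1 / 4 : ℝ) (1 / 2))
      (fun x hx => (hD x (by linarith [hx.1])).continuousAt.continuousWithinAt)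
      (fun x hx => (hD x (by linarith [(interior_subset hx).1])
        ).differentiableAt.differentiableWithinAt)
      (fun x hx => by
        rw [interior_Icc] at hx
        have hx0 : 0 < x := by linarith [hx.1]
        rw [(hD x hx0).deriv, fX x ⟨hx.1.le, by linarith [hx.2]⟩]
        have : Y ≤ X / x ^ n := by
          rw [le_div_iff₀ (pow_pos hx0 n), hY, mul_assoc, mul_comm (2 ^ n), hpow x]
          exact mul_le_of_le_one_right hX.le
            (pow_le_one₀ (by linarith) (by linarith [hx.2]))
        linarith) hz ⟨by norm_num, le_rfl⟩ hz.2
    simp only [hB] at this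
    linarith
  have hmid : ∀ z ∈ Set.Icc (1 / 2 : ℝ) b, -(Y * (b - 1 / 2)) ≤ radialPotential n g z := by
    intro z hz
    have := monotoneOn_of_deriv_nonneg (convex_Icc (1 / 2 : ℝ) b)
      (fun x hx => (hD x (by linarith [hx.1])).continuousAt.continuousWithinAt)
      (fun x hx => (hD x (by linarith [(interior_subset hx).1])
        ).differentiableAt.differentiableWithinAt)
      (fun x hx => by
        rw [interior_Icc] at hx
        have hx0 : 0 < x := by linarith [hx.1]
        rw [(hD x hx0).deriv]
        have : radialFlux n g x / x ^ n ≤ Y := by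
          rw [div_le_iff₀ (pow_pos hx0 n), hY, mul_assoc, mul_comm (2 ^ n), hpow x]
          exact (fle x ⟨by linarith [hx.1], hx.2.le⟩).trans (le_mul_of_one_le_right hX.le
            (one_le_pow₀ (by linarith [hx.1])))
        linarith) ⟨le_rfl, by linarith⟩ hz hz.1
    simp only [hB] at this
    have := mul_le_mul_of_nonneg_left hz.2 hY0.le
    linarith
  have hup : ∀ z ∈ Set.Icc (1 / 2 : ℝ) 1, -(Y * (b - 1 / 2)) ≤ radialPotential n g z := by
    intro z hz
    rcases le_total z b with h | h
    · exact hmid z ⟨hz.1, h⟩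
    · exact (hmid b ⟨by linarith, le_rfl⟩).trans (radialPotential_mono hg (by linarith)
        (fun x hx => fneg x ⟨hx.1.le, hx.2.le⟩) ⟨le_rfl, hb1.le⟩ ⟨h, hz.2⟩ h)
  have hc := continuous_radialPotential hg n
  have hi : Continuous fun s => s ^ n * radialPotential n g s ^ 3 := by fun_prop
  have I1 : 0 ≤ ∫ s in (0 : ℝ)..(1 / 4), s ^ n * radialPotential n g s ^ 3 :=
    intervalIntegral.integral_nonneg (by norm_num) fun s hs =>
      mul_nonneg (pow_nonneg hs.1 n) (pow_nonneg (hnn s ⟨hs.1, by linarith [hs.2]⟩) 3)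
  have I2 : (1 / 8 : ℝ) * ((1 / 4) ^ n * (Y * (1 / 8)) ^ 3)
      ≤ ∫ s in (1 / 4 : ℝ)..(3 / 8), s ^ n * radialPotential n g s ^ 3 := by
    have := intervalIntegral.integral_mono_on (μ := MeasureTheory.volume) (a := (1 / 4 : ℝ))
      (b := 3 / 8) (f := fun _ => (1 / 4 : ℝ) ^ n * (Y * (1 / 8)) ^ 3) (by norm_num)
      intervalIntegrable_const (hi.intervalIntegrable _ _) fun s hs => by
        have h1 : Y * (1 / 8) ≤ radialPotential n g s :=
          (mul_le_mul_of_nonneg_left (by linarith [hs.2]) hY0.le).trans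
            (hlow s ⟨hs.1, by linarith [hs.2]⟩)
        have h2 := hs.1
        gcongr
    rw [intervalIntegral.integral_const] at this
    norm_num at this ⊢
    exact this
  have I3 : 0 ≤ ∫ s in (3 / 8 : ℝ)..(1 / 2), s ^ n * radialPotential n g s ^ 3 :=
    intervalIntegral.integral_nonneg (by norm_num) fun s hs =>
      mul_nonneg (pow_nonneg (by linarith [hs.1]) n)
        (pow_nonneg (hnn s ⟨by linarith [hs.1], hs.2⟩) 3)
  have I4 : (1 / 2 : ℝ) * -(Y * (b - 1 / 2)) ^ 3
      ≤ ∫ s in (1 / 2 : ℝ)..1, s ^ n * radialPotential n g s ^ 3 := by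
    have := intervalIntegral.integral_mono_on (μ := MeasureTheory.volume) (a := (1 / 2 : ℝ))
      (b := 1) (f := fun _ => -(Y * (b - 1 / 2)) ^ 3) (by norm_num)
      intervalIntegrable_const (hi.intervalIntegrable _ _) fun s hs => by
        have h1 : (-(Y * (b - 1 / 2))) ^ 3 ≤ radialPotential n g s ^ 3 :=
          (Odd.strictMono_pow (by decide)).monotone (hup s hs)
        rw [Odd.neg_pow (by decide)] at h1
        have h2 : 0 ≤ (Y * (b - 1 / 2)) ^ 3 :=
          pow_nonneg (mul_nonneg hY0.le (by linarith)) 3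
        have h3 : 0 ≤ s ^ n := pow_nonneg (by linarith [hs.1]) n
        have h4 : s ^ n ≤ 1 := pow_le_one₀ (by linarith [hs.1]) hs.2
        have h5 := mul_le_mul_of_nonneg_left h1 h3
        have h6 := mul_le_mul_of_nonneg_right h4 h2
        linarith
    rw [intervalIntegral.integral_const] at this
    norm_num at this ⊢
    exact this
  have hsum : cubicMoment n g = (∫ s in (0 : ℝ)..(1 / 4), s ^ n * radialPotential n g s ^ 3)
      + (∫ s in (1 / 4 : ℝ)..(3 / 8), s ^ n * radialPotential n g s ^ 3)
      + (∫ s in (3 / 8 : ℝ)..(1 / 2), s ^ n * radialPotential n g s ^ 3)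
      + ∫ s in (1 / 2 : ℝ)..1, s ^ n * radialPotential n g s ^ 3 := by
    rw [intervalIntegral.integral_add_adjacent_intervals (hi.intervalIntegrable _ _)
        (hi.intervalIntegrable _ _),
      intervalIntegral.integral_add_adjacent_intervals (hi.intervalIntegrable _ _)
        (hi.intervalIntegrable _ _),
      intervalIntegral.integral_add_adjacent_intervals (hi.intervalIntegrable _ _)
        (hi.intervalIntegrable _ _)]
    rfl
  -- The gain in `I2` is `Y³ (1/4)ⁿ / 4096`, while the loss in `I4` is at most `Y³ (1/4)ⁿ / 65536`.
  have hη : (b - 1 / 2) ^ 3 ≤ (1 / 4) ^ n / 32768 := by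
    have h1 : (b - 1 / 2) ^ 3 ≤ ((1 / 4) ^ (n + 1) / 8) ^ 3 := by
      have : 0 ≤ b - 1 / 2 := by linarith
      have : b - 1 / 2 ≤ (1 / 4) ^ (n + 1) / 8 := by linarith
      gcongr
    have hp0 : (0 : ℝ) < (1 / 4) ^ n := by positivity
    have hp1 : ((1 : ℝ) / 4) ^ n ≤ 1 := pow_le_one₀ (by norm_num) (by norm_num)
    have h2 : ((1 : ℝ) / 4) ^ n * (1 / 4) ^ n * (1 / 4) ^ n ≤ (1 / 4) ^ n :=
      mul_le_of_le_one_left hp0.le (mul_le_one₀ hp1 hp0.le hp1)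
    have h3 : (((1 : ℝ) / 4) ^ (n + 1) / 8) ^ 3
        = (1 / 4) ^ n * (1 / 4) ^ n * (1 / 4) ^ n / 32768 := by ring
    linarith
  have hYη := mul_le_mul_of_nonneg_left hη (pow_pos hY0 3).le
  have hp : 0 < Y ^ 3 * (1 / 4) ^ n := by positivity
  rw [hsum]
  rw [mul_pow] at I2 I4
  linarith

theorem exists_bump_balancing_all_moments (n : ℕ) {a b : ℝ} (ha : 1 / 2 < a) (hab : a < b)
    (hb : b ≤ 1 / 2 + (1 / 4) ^ (n + 1) / 8) {g : ℝ → ℝ} (hg : Continuous g) :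
    ∃ φ : ℝ → ℝ, IsEvenBump ((1 + b) / 2) φ ∧
      radialFlux n (fun z => g z + cubicWeight a b z * φ z) 1 = 0 ∧
      radialPotential n (fun z => g z + cubicWeight a b z * φ z) (1 / 2) = 0 ∧
      cubicMoment n (fun z => g z + cubicWeight a b z * φ z) = 0 := by
  have hb1 : b < 1 := by
    have : ((1 : ℝ) / 4) ^ (n + 1) ≤ 1 := pow_le_one₀ (by norm_num) (by norm_num)
    linarith
  have hw := (contDiff_cubicWeight a b).continuous
  obtain ⟨q₀, b0, F0, B0⟩ := exists_balancing_bump n ha.le hab hb1 hg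
  obtain ⟨q₁, b1, F1, B1, M1⟩ := exists_bump_cubicMoment_pos n ha hab hb
  obtain ⟨q₂, b2, F2, B2, M2⟩ := exists_bump_cubicMoment_neg n ha hab hb1
  have c0 := hg.fun_add (hw.fun_mul b0.contDiff.continuous)
  have step : ∀ (q : ℝ → ℝ) (t : ℝ), IsEvenBump ((1 + b) / 2) q → 0 ≤ t →
      radialFlux n (fun z => cubicWeight a b z * q z) 1 = 0 →
      radialPotential n (fun z => cubicWeight a b z * q z) (1 / 2) = 0 →
      cubicMoment n (fun z => g z + cubicWeight a b z * q₀ z + t * (cubicWeight a b z * q z)) = 0 →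
      ∃ φ : ℝ → ℝ, IsEvenBump ((1 + b) / 2) φ ∧
        radialFlux n (fun z => g z + cubicWeight a b z * φ z) 1 = 0 ∧
        radialPotential n (fun z => g z + cubicWeight a b z * φ z) (1 / 2) = 0 ∧
        cubicMoment n (fun z => g z + cubicWeight a b z * φ z) = 0 := by
    intro q t hq ht hF hB hM
    have e : (fun z => g z + cubicWeight a b z * (q₀ z + t * q z)) =
        fun z => g z + cubicWeight a b z * q₀ z + t * (cubicWeight a b z * q z) := by
      ext; ring
    refine ⟨_, b0.add (hq.const_mul ht), ?_, ?_, ?_⟩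
    · rw [e, radialFlux_add_smul c0 (hw.fun_mul hq.contDiff.continuous), F0, hF]; ring
    · rw [e, radialPotential_add_smul c0 (hw.fun_mul hq.contDiff.continuous), B0, hB]; ring
    · rw [e, hM]
  obtain ⟨t, ht, h | h⟩ := exists_cubicMoment_eq_zero c0 (hw.fun_mul b1.contDiff.continuous)
    (hw.fun_mul b2.contDiff.continuous) M1 M2
  · exact step q₁ t b1 ht F1 B1 h
  · exact step q₂ t b2 ht F2 B2 h

/-! ### The smooth cube root and the construction of `A`, `B`, `C`. -/

/-- Inside the unit interval the base is positive. At and beyond `±1` the bump is locally absent,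
and the cube root of a flat function with positive coefficient is flat with exponents divided by
three. -/
theorem contDiff_rpow_third_flatGlue_add {ρ φ : ℝ → ℝ} {c α d : ℝ} (hc : 0 < c)
    (hρ : ContDiff ℝ ∞ ρ) (hpos : ∀ y, 0 < ρ y) (hφ : IsEvenBump d φ) (hd : d < 1) :
    ContDiff ℝ ∞ fun z => (flatGlue c α ρ (1 - z ^ 2) + φ z) ^ (1 / 3 : ℝ) := by
  have h1 : ContDiff ℝ ∞ fun z : ℝ => 1 - z ^ 2 := by fun_prop
  have hp : ContDiff ℝ ∞ fun z => flatGlue c α ρ (1 - z ^ 2) + φ z :=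
    ((contDiff_flatGlue hc α hρ).comp h1).add hφ.contDiff
  refine contDiff_iff_contDiffAt.2 fun z => ?_
  rcases lt_or_ge 0 (1 - z ^ 2) with hz | hz
  · exact hp.contDiffAt.rpow_const_of_ne
      (add_pos_of_pos_of_nonneg (flatGlue_pos hz (hpos _)) (hφ.nonneg z)).ne'
  · have h2 : ContDiff ℝ ∞ fun z : ℝ =>
        flatGlue (c / 3) (α / 3) (fun y => ρ y ^ (1 / 3 : ℝ)) (1 - z ^ 2) :=
      (contDiff_flatGlue (by positivity) _ (contDiff_rpow_of_pos hρ hpos _)).comp h1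
    refine h2.contDiffAt.congr_of_eventuallyEq ?_
    have hdz : d < |z| := hd.trans_le ((one_le_sq_iff_one_le_abs z).1 (by linarith))
    filter_upwards [(isOpen_lt continuous_const continuous_abs).mem_nhds hdz] with x hx
    have hφx : φ x = 0 := by
      rcases le_total 0 x with h | h
      · exact hφ.eq_zero x (by rw [← abs_of_nonneg h]; exact (le_of_lt hx))
      · rw [← hφ.even]
        exact hφ.eq_zero _ (by rw [← abs_of_nonpos h]; exact (le_of_lt hx))
    have hcube : flatGlue (c / 3) (α / 3) (fun y => ρ y ^ (1 / 3 : ℝ)) (1 - x ^ 2) ^ 3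
        = flatGlue c α ρ (1 - x ^ 2) := by
      rw [flatGlue_cube, mul_div_cancel₀ c three_ne_zero, mul_div_cancel₀ α three_ne_zero]
      simp only [rpow_third_cube (hpos _).le]
    have hnn : 0 ≤ flatGlue (c / 3) (α / 3) (fun y => ρ y ^ (1 / 3 : ℝ)) (1 - x ^ 2) := by
      rcases le_or_gt (1 - x ^ 2) 0 with h | h
      · rw [flatGlue_of_nonpos h]
      · exact (flatGlue_pos (q := fun y => ρ y ^ (1 / 3 : ℝ)) h
          (Real.rpow_pos_of_pos (hpos _) _)).le
    rw [hφx, add_zero, ← hcube, ← Real.rpow_natCast_mul hnn]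
    norm_num

theorem tsupport_subset_Icc_of_even {f : ℝ → ℝ} (he : ∀ z, f (-z) = f z)
    (h0 : ∀ z, 1 ≤ z → f z = 0) : tsupport f ⊆ Set.Icc (-1) 1 := by
  refine closure_minimal (fun z hz => ?_) isClosed_Icc
  by_contra h
  refine hz ?_
  rw [Set.mem_Icc, not_and_or, not_le, not_le] at h
  rcases h with h | h
  · rw [← he]; exact h0 _ (by linarith)
  · exact h0 z h.le

theorem mainTheorem3 (N : ℕ) (hN : 1 ≤ N) :
    ∃ (A B C : ℝ → ℝ) (δ : ℝ),
      -- smoothness on the whole line, and `0 < δ < 1/2`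
      (ContDiff ℝ ∞ A ∧ ContDiff ℝ ∞ B ∧ ContDiff ℝ ∞ C) ∧
      δ ∈ Set.Ioo (0 : ℝ) (1 / 2) ∧
      -- the (closed) supports lie in `[-1, 1]`
      (tsupport A ⊆ Set.Icc (-1) 1 ∧ tsupport B ⊆ Set.Icc (-1) 1 ∧
        tsupport C ⊆ Set.Icc (-1) 1) ∧
      -- `B` and `C` are simultaneously nonzero somewhere on `(0, ∞)`
      {z : ℝ | 0 < z ∧ B z ≠ 0 ∧ C z ≠ 0}.Nonempty ∧
      -- evenness
      (∀ z : ℝ, A z = A (-z) ∧ B z = B (-z) ∧ C z = C (-z)) ∧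
      -- explicit form of `A` near `1`
      (∀ z : ℝ, 1 - δ < z → z < 1 → A z = Real.exp (-1 / (1 - z ^ 2))) ∧
      -- the two equations away from `0`
      (∀ z : ℝ, z ≠ 0 →
        -(deriv (deriv A) z) - ((N : ℝ) - 1) / z * deriv A z = B z ^ 3) ∧
      (∀ z : ℝ, z ≠ 0 →
        -(deriv (deriv B) z) - ((N : ℝ) - 1) / z * deriv B z = C z ^ 3) ∧
      -- zeros of `B` and `C` in `[0, 1)`
      (∀ z : ℝ, (B z = 0 ∧ z ∈ Set.Ico (0 : ℝ) 1) ↔ z = 1 / 2) ∧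
      deriv B (1 / 2) < 0 ∧
      0 < C (1 / 2) ∧
      (∀ z : ℝ, (C z = 0 ∧ z ∈ Set.Ico (0 : ℝ) 1) →
        (z ∈ Set.Ioo (0 : ℝ) 1 ∧ deriv C z ≠ 0)) := by
  obtain ⟨n, rfl⟩ : ∃ n, N = n + 1 := ⟨N - 1, by omega⟩
  have hη1 : ((1 : ℝ) / 4) ^ (n + 1) ≤ 1 := pow_le_one₀ (by norm_num) (by norm_num)
  have hη0 : (0 : ℝ) < (1 / 4) ^ (n + 1) := by positivity
  obtain ⟨b, hb⟩ : ∃ b : ℝ, b = 1 / 2 + (1 / 4) ^ (n + 1) / 8 := ⟨_, rfl⟩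
  have hb1 : b < 1 := by linarith
  obtain ⟨a, ha, hab⟩ := exists_between (show (1 : ℝ) / 2 < b by linarith)
  have ha0 : 0 ≤ a := by linarith
  -- The weight depends only on `z²`, so it can be divided out of the boundary profile in the
  -- variable `y = 1 - z²`.
  have hWw : ∀ z : ℝ, ((1 - (1 - z ^ 2) - a ^ 2) * (1 - (1 - z ^ 2) - b ^ 2)) ^ 3
      = cubicWeight a b z := fun z => by rw [cubicWeight]; ring
  obtain ⟨ε, hε, q, ρ, hq, hρ, hρpos, eqE, eqq⟩ := exists_boundary_profile n
    (W := fun y => ((1 - y - a ^ 2) * (1 - y - b ^ 2)) ^ 3) (by fun_prop) (by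
      have := cubicWeight_pos_of_gt ha0 hab hb1
      rw [← hWw] at this
      simpa using this)
  simp only [hWw] at eqq
  have hy : ContDiff ℝ ∞ fun z : ℝ => 1 - z ^ 2 := by fun_prop
  have hw := contDiff_cubicWeight a b
  have hp₀ : ContDiff ℝ ∞ fun z : ℝ => flatGlue (1 / 3) (16 / 3) ρ (1 - z ^ 2) :=
    (contDiff_flatGlue (by norm_num) _ hρ).comp hy
  obtain ⟨φ, hφ, hF, hB, hM⟩ := exists_bump_balancing_all_moments n ha hab hb.le
    (hw.continuous.fun_mul hp₀.continuous)
  have hC' := contDiff_rpow_third_flatGlue_add (c := 1 / 3) (α := 16 / 3) (by norm_num) hρ hρpos hφ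
    (by linarith)
  obtain ⟨p, hp⟩ : ∃ p : ℝ → ℝ, p = fun z => flatGlue (1 / 3) (16 / 3) ρ (1 - z ^ 2) + φ z :=
    ⟨_, rfl⟩
  have hpz : ∀ z, p z = flatGlue (1 / 3) (16 / 3) ρ (1 - z ^ 2) + φ z := fun z => by rw [hp]
  simp only [← mul_add, ← hpz] at hF hB hM hC'
  have hpc : ContDiff ℝ ∞ p := by rw [hp]; exact hp₀.add hφ.contDiff
  have hpe : ∀ z, p (-z) = p z := fun z => by rw [hpz, hpz, hφ.even, neg_sq]
  have hp1 : ∀ z, 1 ≤ z → p z = 0 := fun z hz => by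
    rw [hpz, hφ.eq_zero z (by linarith), flatGlue_of_nonpos (sub_nonpos.2 (one_le_pow₀ hz)), add_zero]
  have hppos : ∀ z ∈ Set.Ico (0 : ℝ) 1, 0 < p z := fun z hz => by
    rw [hpz]
    exact add_pos_of_pos_of_nonneg (flatGlue_pos (sub_pos.2 (pow_lt_one₀ hz.1 hz.2 two_ne_zero)) (hρpos _))
      (hφ.nonneg z)
  have hp0 : ∀ z, 0 ≤ p z := by
    have : ∀ z, 0 ≤ z → 0 ≤ p z := fun z hz => by
      rcases lt_or_ge z 1 with h | h
      · exact (hppos z ⟨hz, h⟩).le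
      · exact (hp1 z h).ge
    intro z
    rcases le_total 0 z with h | h
    · exact this z h
    · rw [← hpe]; exact this _ (by linarith)
  obtain ⟨g, hg⟩ : ∃ g : ℝ → ℝ, g = fun z => cubicWeight a b z * p z := ⟨_, rfl⟩
  have hgz : ∀ z, g z = cubicWeight a b z * p z := fun z => by rw [hg]
  rw [← hg] at hF hB hM
  have hgs : ContDiff ℝ ∞ g := by rw [hg]; exact hw.mul hpc
  have hgc := hgs.continuous
  have hge : ∀ z, g (-z) = g z := fun z => by rw [hgz, hgz, hpe, cubicWeight, cubicWeight, neg_sq]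
  have hg1 : ∀ z, 1 ≤ z → g z = 0 := fun z hz => by rw [hgz, hp1 z hz, mul_zero]
  have s1 : ∀ x ∈ Set.Ioo 0 a, 0 < g x := fun x hx => by
    rw [hgz]
    exact mul_pos (cubicWeight_pos_of_lt hx.1.le hx.2 hab) (hppos x ⟨hx.1.le, by linarith [hx.2]⟩)
  have s2 : ∀ x ∈ Set.Ioo a b, g x < 0 := fun x hx => by
    rw [hgz]
    exact mul_neg_of_neg_of_pos (cubicWeight_neg ha0 hx.1 hx.2)
      (hppos x ⟨by linarith [hx.1], by linarith [hx.2]⟩)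
  have s3 : ∀ x ∈ Set.Ioo b 1, 0 < g x := fun x hx => by
    rw [hgz]
    exact mul_pos (cubicWeight_pos_of_gt ha0 hab hx.1) (hppos x ⟨by linarith [hx.1], hx.2⟩)
  have hBpos := fun z hz => radialPotential_pos_of_pattern (n := n) hgc ha.le s1 hB (z := z) hz
  have hBneg := fun z hz => radialPotential_neg_of_pattern (n := n) hgc ha.le hab.le hb1.le s1 s2 s3
    hF hB (z := z) hz
  have hBs := contDiff_radialPotential hgs n
  have hBe := radialPotential_neg hgc hge n
  have hB1 : ∀ z, 1 ≤ z → radialPotential n g z = 0 := fun z hz =>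
    radialPotential_eq_zero_of_one_le hgc hg1 hF hz
  have hB3 : ContDiff ℝ ∞ fun z => radialPotential n g z ^ 3 := hBs.pow 3
  have hAe := radialPotential_neg hB3.continuous (fun z => by rw [hBe]) n
  have hA1 : ∀ z, 1 ≤ z → radialPotential n (fun z => radialPotential n g z ^ 3) z = 0 :=
    fun z hz => radialPotential_eq_zero_of_one_le hB3.continuous
      (fun z hz => by simp only [hB1 z hz]; norm_num) hM hz
  -- The second bound keeps `z > 1 - δ` beyond the bump, which ends at `(1 + b) / 2`; the third
  -- gives `1 - z² < 2δ ≤ ε`, the range of the boundary profile.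
  obtain ⟨δ, hδ⟩ : ∃ δ, δ = min (1 / 4) (min ((1 - b) / 2) (ε / 2)) := ⟨_, rfl⟩
  have hδ0 : 0 < δ := by
    rw [hδ]
    exact lt_min (by norm_num) (lt_min (by linarith) (by linarith))
  have hδ1 : δ ≤ 1 / 4 := hδ ▸ min_le_left _ _
  have hδ2 : δ ≤ (1 - b) / 2 := hδ ▸ (min_le_right _ _).trans (min_le_left _ _)
  have hδ3 : δ ≤ ε / 2 := hδ ▸ (min_le_right _ _).trans (min_le_right _ _)
  have hnear : ∀ z, 1 - δ < z → z ≠ 0 ∧ 1 - z ^ 2 < ε ∧ φ z = 0 := fun z hz =>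
    ⟨by linarith, by
      have h1 : (1 - δ) ^ 2 < z ^ 2 := pow_lt_pow_left₀ hz (by linarith) two_ne_zero
      have h2 : 1 - z ^ 2 < 2 * δ := by linarith [sq_nonneg δ]
      linarith, hφ.eq_zero z (by linarith)⟩
  have hflat0 : ∀ (c α : ℝ) (q : ℝ → ℝ) (z : ℝ), 1 ≤ z → flatGlue c α q (1 - z ^ 2) = 0 :=
    fun c α q z hz => flatGlue_of_nonpos (sub_nonpos.2 (one_le_pow₀ hz))
  have hBnear : Set.EqOn (radialPotential n g) (fun z => flatGlue (1 / 3) (4 / 3) q (1 - z ^ 2))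
      (Set.Ioi (1 - δ)) := by
    refine eqOn_Ioi_of_radial_equation (n := n) (by linarith) (by linarith) hBs
      ((contDiff_flatGlue (by norm_num) _ hq).comp hy) hB1 (hflat0 _ _ _) fun z hz => ?_
    obtain ⟨h0, h1, h2⟩ := hnear z hz
    rw [radialPotential_equation hgs n h0, eqq z h0 h1, hgz, hpz, h2, add_zero]
  have hAnear : Set.EqOn (radialPotential n fun z => radialPotential n g z ^ 3)
      (fun z => flatGlue 1 0 1 (1 - z ^ 2)) (Set.Ioi (1 - δ)) := by
    refine eqOn_Ioi_of_radial_equation (n := n) (by linarith) (by linarith)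
      (contDiff_radialPotential hB3 n)
      ((contDiff_flatGlue one_pos _ contDiff_const).comp hy) hA1 (hflat0 _ _ _) fun z hz => ?_
    obtain ⟨h0, h1, h2⟩ := hnear z hz
    rw [radialPotential_equation hB3 n h0, eqE z h0 h1, hBnear hz]
  have hCs : ContDiff ℝ ∞ fun z => p z ^ (1 / 3 : ℝ) * ((z ^ 2 - a ^ 2) * (z ^ 2 - b ^ 2)) :=
    hC'.mul (by fun_prop)
  have hr : ∀ z ∈ Set.Ico (0 : ℝ) 1, 0 < p z ^ (1 / 3 : ℝ) := fun z hz =>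
    Real.rpow_pos_of_pos (hppos z hz) _
  have hCpos : ∀ z, 0 ≤ z → z < a → 0 < p z ^ (1 / 3 : ℝ) * ((z ^ 2 - a ^ 2) * (z ^ 2 - b ^ 2)) :=
    fun z h0 h1 => mul_pos (hr z ⟨h0, by linarith⟩)
      (mul_pos_of_neg_of_neg
        (sub_neg.2 (pow_lt_pow_left₀ h1 h0 two_ne_zero))
        (sub_neg.2 (pow_lt_pow_left₀ (h1.trans hab) h0 two_ne_zero)))
  have hN : ((n + 1 : ℕ) : ℝ) - 1 = n := by push_cast; ring
  refine ⟨radialPotential n fun z => radialPotential n g z ^ 3, radialPotential n g,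
    fun z => p z ^ (1 / 3 : ℝ) * ((z ^ 2 - a ^ 2) * (z ^ 2 - b ^ 2)), δ,
    ⟨contDiff_radialPotential hB3 n, hBs, hCs⟩, ⟨hδ0, by linarith⟩,
    ⟨tsupport_subset_Icc_of_even hAe hA1, tsupport_subset_Icc_of_even hBe hB1,
      tsupport_subset_Icc_of_even (fun z => by rw [hpe, neg_sq]) fun z hz => ?_⟩,
    ⟨1 / 4, by norm_num, (hBpos _ (by norm_num)).ne', (hCpos _ (by norm_num) (by linarith)).ne'⟩,
    fun z => ⟨(hAe z).symm, (hBe z).symm, by simp only [hpe, neg_sq]⟩, fun z hz hz1 => ?_,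
    fun z hz => ?_, fun z hz => ?_, fun z => ⟨fun ⟨h0, h1⟩ => ?_, ?_⟩, ?_,
    hCpos _ (by norm_num) ha, fun z ⟨h0, h1⟩ => ?_⟩
  · rw [hp1 z hz, Real.zero_rpow (by norm_num), zero_mul]
  · rw [hAnear hz]
    simp only
    rw [flatGlue_of_pos (sub_pos.2 (pow_lt_one₀ (by linarith) hz1 two_ne_zero))]
    simp
  · rw [hN, radialPotential_equation hB3 n hz]
  · rw [hN, radialPotential_equation hgs n hz, mul_pow, rpow_third_cube (hp0 z), hgz, cubicWeight,
      mul_comm]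
  · rcases lt_trichotomy z (1 / 2) with h | h | h
    · exact absurd h0 (hBpos z ⟨h1.1, h⟩).ne'
    · exact h
    · exact absurd h0 (hBneg z ⟨h, h1.2⟩).ne
  · rintro rfl
    exact ⟨hB, by norm_num⟩
  · rw [(hasDerivAt_radialPotential_of_pos hgc (by norm_num)).deriv]
    exact neg_neg_of_pos (div_pos (radialFlux_pos_of_pattern hgc s1 ⟨by norm_num, ha.le⟩)
      (by positivity))
  -- At a zero of `C` exactly one quadratic factor vanishes, and it does so simply since `z > 0`;
  -- only the term differentiating that factor survives.
  · have hrz := (hr z h1).ne'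
    have hd := ((hC'.differentiable (by simp) z).hasDerivAt.fun_mul
      (((hasDerivAt_pow 2 z).sub_const (a ^ 2)).fun_mul
        ((hasDerivAt_pow 2 z).sub_const (b ^ 2)))).deriv
    rw [hd]
    have hlt : a ^ 2 < b ^ 2 := pow_lt_pow_left₀ hab ha0 two_ne_zero
    rcases mul_eq_zero.1 ((mul_eq_zero.1 h0).resolve_left hrz) with h | h
    · have hza : z = a := (pow_left_inj₀ h1.1 ha0 two_ne_zero).1 (sub_eq_zero.1 h)
      have hz0 : 0 < z := by linarith
      have hne : z ^ 2 - b ^ 2 ≠ 0 := by linarith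
      refine ⟨⟨hz0, h1.2⟩, ?_⟩
      rw [h, zero_mul, zero_mul, mul_zero, zero_add, add_zero]
      exact mul_ne_zero hrz (mul_ne_zero (by positivity) hne)
    · have hzb : z = b := (pow_left_inj₀ h1.1 (by linarith) two_ne_zero).1 (sub_eq_zero.1 h)
      have hz0 : 0 < z := by linarith
      have hne : z ^ 2 - a ^ 2 ≠ 0 := by linarith
      refine ⟨⟨hz0, h1.2⟩, ?_⟩
      rw [h, mul_zero, mul_zero, mul_zero, zero_add, zero_add]
      exact mul_ne_zero hrz (mul_ne_zero hne (by positivity))
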